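/- Let $n\ge 1$, let $\vec p=(p_1,\dots,p_n)$ with $1<p_i<\infty$ for every $i$, and let $t,r$ be real numbers with $$1<\frac{n}{\sum_{i=1}^n 1/p_i}<t<r<\infty .$$ All functions are complex-valued measurable functions on $\mathbb R^n$, identified when they agree almost everywhere; $q'$ denotes the conjugate exponent of $q$, $\vec p\,'=(p_1',\dots,p_n')$, and $\mathcal D$ is the family of dyadic cubes $Q_{j,m}=\prod_{i=1}^n[2^{-j}m_i,2^{-j}(m_i+1))$, $j\in\mathbb Z$, $m\in\mathbb Z^n$. Let $$\|f\|_{L^{\vec p}}=\Big(\int_{\mathbb R}\cdots\Big(\int_{\mathbb R}|f(x_1,\dots,x_n)|^{p_1}\,dx_1\Big)^{p_2/p_1}\cdots dx_n\Big)^{1/p_n}.$$ The mixed Bourgain–Morrey space $M_{\vec p}^{t,r}$ consists of all $f$ with $$\|f\|_{M_{\vec p}^{t,r}}=\Big(\sum_{Q\in\mathcal D}|Q|^{\frac rt-\frac rn\sum_i\frac1{p_i}}\,\|f\chi_Q\|_{L^{\vec p}}^r\Big)^{1/r}<\infty .$$ A $(\vec p\,',t')$-block supported on a cube $Q$ is a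 measurable function $b$ that vanishes a.e. outside $Q$ and satisfies $\|b\|_{L^{\vec p\,'}}\le |Q|^{\frac1t-\frac1n\sum_i\frac1{p_i}}$. The block space $\mathcal H_{\vec p\,'}^{t',r'}$ consists of all $g$ that can be written as $g=\sum_{Q\in\mathcal D}\lambda_Q b_Q$, with (unconditional) convergence almost everywhere, where $(\lambda_Q)\in\ell^{r'}(\mathcal D)$ and each $b_Q$ is a $(\vec p\,',t')$-block supported on $Q$; $\|g\|_{\mathcal H_{\vec p\,'}^{t',r'}}$ is the infimum of $\|(\lambda_Q)\|_{\ell^{r'}}$ over all such representations. Then $(M_{\vec p}^{t,r})^*=\mathcal H_{\vec p\,'}^{t',r'}$ in the following sense. (i) If $g\in\mathcal H_{\vec p\,'}^{t',r'}$, then $fg$ is integrable for every $f\in M_{\vec p}^{t,r}$, the linear functional $L_g(f)=\int_{\mathbb R^n}f(x)g(x)\,dx$ is bounded on $M_{\vec p}^{t,r}$, and $\|L_g\|_{(M_{\vec p}^{t,r})^*}=\|g\|_{\mathcal H_{\vec p\,'}^{t',r'}}$. (ii) For every bounded linear functional $L$ on $M_{\vec p}^{t,r}$ there is exactly one $g\in\mathcal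 H_{\vec p\,'}^{t',r'}$ with $L=L_g$. (iii) $M_{\vec p}^{t,r}$ is reflexive, that is, the canonical embedding of $M_{\vec p}^{t,r}$ into its bidual is onto. -/

import Mathlib

open MeasureTheory
open scoped ENNReal

noncomputable section

namespace MixedBourgainMorrey

/-- The iterated (mixed) Lebesgue norm of a nonnegative function on `ℝⁿ`: first the `L^{p₁}` norm
in the variable `x₁`, then the `L^{p₂}` norm in `x₂` of the result, and so on up to `xₙ`. -/
def mixedNorm : {n : ℕ} → (Fin n → ℝ) → ((Fin n → ℝ) → ℝ≥0∞) → ℝ≥0∞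
  | 0, _, F => F Fin.elim0
  | _ + 1, p, F =>
      mixedNorm (Fin.tail p) fun y => (∫⁻ x : ℝ, F (Fin.cons x y) ^ p 0) ^ (1 / p 0)

/-- The mixed Lebesgue norm of a complex function on `ℝⁿ`. -/
def mixedLpNorm {n : ℕ} (p : Fin n → ℝ) (f : (Fin n → ℝ) → ℂ) : ℝ≥0∞ :=
  mixedNorm p fun x => ‖f x‖ₑ

/-- Indices `(j, m) ∈ ℤ × ℤⁿ` of dyadic cubes. -/
abbrev DyadicIndex (n : ℕ) : Type := ℤ × (Fin n → ℤ)

/-- The half-open dyadic cube `∏ᵢ [2⁻ʲ mᵢ, 2⁻ʲ (mᵢ + 1))`. -/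
def dyadicCube {n : ℕ} (k : DyadicIndex n) : Set (Fin n → ℝ) :=
  Set.pi Set.univ fun i =>
    Set.Ico ((2 : ℝ) ^ (-k.1) * (k.2 i : ℝ)) ((2 : ℝ) ^ (-k.1) * ((k.2 i : ℝ) + 1))

/-- The mixed Bourgain–Morrey norm
`(∑_Q |Q|^{r/t - (r/n) ∑ 1/pᵢ} ‖f χ_Q‖_{L^p}^r)^{1/r}`, the sum being over all dyadic cubes. -/
def bmNorm {n : ℕ} (p : Fin n → ℝ) (t r : ℝ) (f : (Fin n → ℝ) → ℂ) : ℝ≥0∞ :=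
  (∑' k : DyadicIndex n,
    volume (dyadicCube k) ^ (r / t - r / n * ∑ i, 1 / p i) *
      mixedLpNorm p ((dyadicCube k).indicator f) ^ r) ^ (1 / r)

/-- `b` is a `(p', t')`-block supported on the cube `Q`. The exponents `p` and `t` are the
unprimed ones. -/
def IsBlock {n : ℕ} (p : Fin n → ℝ) (t : ℝ) (Q : Set (Fin n → ℝ)) (b : (Fin n → ℝ) → ℂ) : Prop :=
  AEStronglyMeasurable b volume ∧ (∀ᵐ x, x ∉ Q → b x = 0) ∧
    mixedLpNorm (fun i => (p i).conjExponent) b ≤ volume Q ^ (1 / t - 1 / n * ∑ i, 1 / p i)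

/-- `c` is an admissible coefficient family for `g`: it lies in `ℓ^{r'}`, and
`g = ∑ c_k b_k` almost everywhere with `(p', t')`-blocks `b_k` supported on the dyadic cubes. -/
def IsAdmissible {n : ℕ} (p : Fin n → ℝ) (t r : ℝ) (g : (Fin n → ℝ) →ₘ[volume] ℂ)
    (c : DyadicIndex n → ℂ) : Prop :=
  (Summable fun k => ‖c k‖ ^ r.conjExponent) ∧
    ∃ b : DyadicIndex n → (Fin n → ℝ) → ℂ, (∀ k, IsBlock p t (dyadicCube k) (b k)) ∧
      ∀ᵐ x, HasSum (fun k => c k * b k x) (g x)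

/-- The block space `H_{p'}^{t',r'}`, whose parameters are given through the unprimed exponents
`p, t, r`. Functions that agree almost everywhere are identified. -/
def blockSpace {n : ℕ} (p : Fin n → ℝ) (t r : ℝ) : Set ((Fin n → ℝ) →ₘ[volume] ℂ) :=
  {g | ∃ c, IsAdmissible p t r g c}

/-- The norm of `H_{p'}^{t',r'}`: the infimum of `‖c‖_{ℓ^{r'}}` over all admissible `c`. -/
def blockNorm {n : ℕ} (p : Fin n → ℝ) (t r : ℝ) (g : (Fin n → ℝ) →ₘ[volume] ℂ) : ℝ :=
  sInf {a | ∃ c, IsAdmissible p t r g c ∧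
    a = (∑' k, ‖c k‖ ^ r.conjExponent) ^ (1 / r.conjExponent)}

/-! Facts needed to see that the mixed Bourgain–Morrey functions form a normed space. -/

theorem ae_ae_cons {n : ℕ} {P : (Fin (n + 1) → ℝ) → Prop} (h : ∀ᵐ z, P z) :
    ∀ᵐ y : Fin n → ℝ, ∀ᵐ x : ℝ, P (Fin.cons x y) := by
  have e := (volume_preserving_piFinSuccAbove (fun _ : Fin (n + 1) => ℝ) 0).symm
  have h1 := e.quasiMeasurePreserving.ae h
  have h2 := (Measure.measurePreserving_swap (μ := (volume : Measure (Fin n → ℝ)))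
    (ν := (volume : Measure ℝ))).quasiMeasurePreserving.ae h1
  have h3 := Measure.ae_ae_of_ae_prod h2
  filter_upwards [h3] with y hy
  filter_upwards [hy] with x hx
  simpa [MeasurableEquiv.piFinSuccAbove_symm_apply, Fin.insertNthEquiv] using hx

theorem ae_of_ae_ae_cons {n : ℕ} {P : (Fin (n + 1) → ℝ) → Prop} (hP : MeasurableSet {z | P z})
    (h : ∀ᵐ y : Fin n → ℝ, ∀ᵐ x : ℝ, P (Fin.cons x y)) : ∀ᵐ z, P z := by
  have e := volume_preserving_piFinSuccAbove (fun _ : Fin (n + 1) => ℝ) 0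
  have hm : Measurable fun q : (Fin n → ℝ) × ℝ => (Fin.cons q.2 q.1 : Fin (n + 1) → ℝ) := by
    refine measurable_pi_lambda _ fun i => ?_
    refine Fin.cases ?_ (fun j => ?_) i
    · simpa using measurable_snd
    · exact (measurable_pi_apply j).comp measurable_fst
  have h2 : ∀ᵐ q : (Fin n → ℝ) × ℝ, P (Fin.cons q.2 q.1) :=
    (Measure.ae_prod_iff_ae_ae (p := fun q : (Fin n → ℝ) × ℝ => P (Fin.cons q.2 q.1))
      (hm hP)).2 h
  have h3 := (Measure.measurePreserving_swap (μ := (volume : Measure ℝ))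
    (ν := (volume : Measure (Fin n → ℝ)))).quasiMeasurePreserving.ae h2
  filter_upwards [e.quasiMeasurePreserving.ae h3] with z hz
  have : (Fin.cons (z 0) (fun j : Fin n => z j.succ) : Fin (n + 1) → ℝ) = z := Fin.cons_self_tail z
  have hz' : P (Fin.cons (z 0) (fun j : Fin n => z j.succ)) := hz
  rwa [this] at hz'

theorem measurable_section {n : ℕ} {F : (Fin (n + 1) → ℝ) → ℝ≥0∞} (hF : Measurable F) :
    Measurable fun q : (Fin n → ℝ) × ℝ => F (Fin.cons q.2 q.1) := by
  refine hF.comp (measurable_pi_lambda _ fun i => ?_)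
  refine Fin.cases ?_ (fun j => ?_) i
  · simpa using measurable_snd
  · exact (measurable_pi_apply j).comp measurable_fst

theorem measurable_inner {n : ℕ} (q : ℝ) {F : (Fin (n + 1) → ℝ) → ℝ≥0∞} (hF : Measurable F) :
    Measurable fun y : Fin n → ℝ => (∫⁻ x : ℝ, F (Fin.cons x y) ^ q) ^ (1 / q) :=
  (((measurable_section hF).pow_const q).lintegral_prod_right').pow_const _

theorem mixedNorm_mono {n : ℕ} (p : Fin n → ℝ) (hp : ∀ i, 1 < p i) {F G : (Fin n → ℝ) → ℝ≥0∞}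
    (h : ∀ᵐ x, F x ≤ G x) : mixedNorm p F ≤ mixedNorm p G := by
  induction n with
  | zero =>
    obtain ⟨x, hx⟩ := h.exists
    rw [Subsingleton.elim x Fin.elim0] at hx
    exact hx
  | succ n ih =>
    refine ih (Fin.tail p) (fun i => hp i.succ) ?_
    filter_upwards [ae_ae_cons h] with y hy
    have h0 : 0 ≤ p 0 := (zero_lt_one.trans (hp 0)).le
    refine ENNReal.rpow_le_rpow (lintegral_mono_ae ?_) (one_div_nonneg.2 h0)
    filter_upwards [hy] with x hx
    exact ENNReal.rpow_le_rpow hx h0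

theorem mixedNorm_add_le {n : ℕ} (p : Fin n → ℝ) (hp : ∀ i, 1 < p i)
    {F G : (Fin n → ℝ) → ℝ≥0∞} (hF : Measurable F) (hG : Measurable G) :
    mixedNorm p (fun x => F x + G x) ≤ mixedNorm p F + mixedNorm p G := by
  induction n with
  | zero => exact le_rfl
  | succ n ih =>
    refine le_trans (mixedNorm_mono (Fin.tail p) (fun i => hp i.succ)
      (Filter.Eventually.of_forall fun y => ?_))
      (ih (Fin.tail p) (fun i => hp i.succ) (measurable_inner _ hF) (measurable_inner _ hG))
    exact ENNReal.lintegral_Lp_add_le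
      ((measurable_section hF).comp measurable_prodMk_left).aemeasurable
      ((measurable_section hG).comp measurable_prodMk_left).aemeasurable (hp 0).le

theorem mixedNorm_const_mul {n : ℕ} (p : Fin n → ℝ) (hp : ∀ i, 1 < p i)
    (F : (Fin n → ℝ) → ℝ≥0∞) {a : ℝ≥0∞} (ha : a ≠ ∞) :
    mixedNorm p (fun x => a * F x) = a * mixedNorm p F := by
  induction n with
  | zero => rfl
  | succ n ih =>
    have h0 : 0 < p 0 := zero_lt_one.trans (hp 0)
    simp only [mixedNorm]
    rw [← ih (Fin.tail p) (fun i => hp i.succ)]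
    congr 1
    funext y
    simp_rw [ENNReal.mul_rpow_of_nonneg _ _ h0.le]
    rw [lintegral_const_mul' _ _ (ENNReal.rpow_ne_top_of_nonneg h0.le ha),
      ENNReal.mul_rpow_of_nonneg _ _ (one_div_nonneg.2 h0.le), ← ENNReal.rpow_mul,
      mul_one_div_cancel h0.ne', ENNReal.rpow_one]

theorem ae_eq_zero_of_mixedNorm {n : ℕ} (p : Fin n → ℝ) (hp : ∀ i, 1 < p i)
    {F : (Fin n → ℝ) → ℝ≥0∞} (hF : Measurable F) (h : mixedNorm p F = 0) : ∀ᵐ x, F x = 0 := by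
  induction n with
  | zero =>
    refine Filter.Eventually.of_forall fun x => ?_
    rw [Subsingleton.elim x Fin.elim0]
    exact h
  | succ n ih =>
    have h0 : 0 < p 0 := zero_lt_one.trans (hp 0)
    refine ae_of_ae_ae_cons (hF (measurableSet_singleton 0)) ?_
    filter_upwards [ih (Fin.tail p) (fun i => hp i.succ) (measurable_inner _ hF) h] with y hy
    have hm : Measurable fun x : ℝ => F (Fin.cons x y) ^ p 0 :=
      ((measurable_section hF).comp measurable_prodMk_left).pow_const _
    rw [ENNReal.rpow_eq_zero_iff_of_pos (one_div_pos.2 h0), lintegral_eq_zero_iff hm] at hy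
    filter_upwards [hy] with x hx
    exact (ENNReal.rpow_eq_zero_iff_of_pos h0).1 hx

theorem measurableSet_dyadicCube {n : ℕ} (k : DyadicIndex n) : MeasurableSet (dyadicCube k) :=
  MeasurableSet.univ_pi fun _ => measurableSet_Ico

theorem volume_dyadicCube {n : ℕ} (k : DyadicIndex n) :
    volume (dyadicCube k) = ENNReal.ofReal ((2 : ℝ) ^ (-k.1)) ^ n := by
  rw [dyadicCube, volume_pi_pi]
  simp [mul_add]

theorem mixedLpNorm_add_le {n : ℕ} (p : Fin n → ℝ) (hp : ∀ i, 1 < p i)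
    {f g : (Fin n → ℝ) → ℂ} (hf : Measurable f) (hg : Measurable g) :
    mixedLpNorm p (f + g) ≤ mixedLpNorm p f + mixedLpNorm p g :=
  (mixedNorm_mono p hp (Filter.Eventually.of_forall fun x => enorm_add_le (f x) (g x))).trans
    (mixedNorm_add_le p hp hf.enorm hg.enorm)

theorem bmNorm_mono {n : ℕ} (p : Fin n → ℝ) (hp : ∀ i, 1 < p i) (t r : ℝ) (hr : 1 < r)
    {f g : (Fin n → ℝ) → ℂ} (h : ∀ᵐ x, ‖f x‖ₑ ≤ ‖g x‖ₑ) : bmNorm p t r f ≤ bmNorm p t r g := by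
  have h0 : 0 < r := zero_lt_one.trans hr
  refine ENNReal.rpow_le_rpow (ENNReal.tsum_le_tsum fun k => ?_) (one_div_nonneg.2 h0.le)
  refine mul_le_mul_right (ENNReal.rpow_le_rpow (mixedNorm_mono p hp ?_) h0.le) _
  filter_upwards [h] with x hx
  by_cases hk : x ∈ dyadicCube k <;> simp [hk, hx]

theorem bmNorm_congr {n : ℕ} (p : Fin n → ℝ) (hp : ∀ i, 1 < p i) (t r : ℝ) (hr : 1 < r)
    {f g : (Fin n → ℝ) → ℂ} (h : f =ᵐ[volume] g) : bmNorm p t r f = bmNorm p t r g :=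
  le_antisymm
    (bmNorm_mono p hp t r hr (by filter_upwards [h] with x hx; rw [hx]))
    (bmNorm_mono p hp t r hr (by filter_upwards [h] with x hx; rw [hx]))

theorem bmNorm_eq {n : ℕ} (p : Fin n → ℝ) (t r : ℝ) (hr : 1 < r) (f : (Fin n → ℝ) → ℂ) :
    bmNorm p t r f = (∫⁻ k : DyadicIndex n,
      (volume (dyadicCube k) ^ (1 / t - 1 / n * ∑ i, 1 / p i) *
        mixedLpNorm p ((dyadicCube k).indicator f)) ^ r ∂(@Measure.count _ ⊤)) ^ (1 / r) := by
  let _ : MeasurableSpace (DyadicIndex n) := ⊤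
  have h0 : 0 < r := zero_lt_one.trans hr
  rw [lintegral_count]
  simp_rw [ENNReal.mul_rpow_of_nonneg _ _ h0.le, ← ENNReal.rpow_mul]
  rw [bmNorm]
  congr 3
  funext k
  congr 2
  ring

theorem bmNorm_add_le {n : ℕ} (p : Fin n → ℝ) (hp : ∀ i, 1 < p i) (t r : ℝ) (hr : 1 < r)
    {f g : (Fin n → ℝ) → ℂ} (hf : Measurable f) (hg : Measurable g) :
    bmNorm p t r (f + g) ≤ bmNorm p t r f + bmNorm p t r g := by
  let _ : MeasurableSpace (DyadicIndex n) := ⊤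
  have h0 : 0 < r := zero_lt_one.trans hr
  simp_rw [bmNorm_eq p t r hr]
  refine le_trans ?_ (ENNReal.lintegral_Lp_add_le (μ := @Measure.count _ ⊤)
    (measurable_from_top).aemeasurable (measurable_from_top).aemeasurable hr.le)
  refine ENNReal.rpow_le_rpow (lintegral_mono fun k => ENNReal.rpow_le_rpow ?_ h0.le)
    (one_div_nonneg.2 h0.le)
  rw [Pi.add_apply, ← mul_add, Set.indicator_add']
  exact mul_le_mul_right (mixedLpNorm_add_le p hp (hf.indicator (measurableSet_dyadicCube k))
    (hg.indicator (measurableSet_dyadicCube k))) _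

theorem bmNorm_smul {n : ℕ} (p : Fin n → ℝ) (hp : ∀ i, 1 < p i) (t r : ℝ) (hr : 1 < r)
    (a : ℂ) (f : (Fin n → ℝ) → ℂ) : bmNorm p t r (a • f) = ‖a‖ₑ * bmNorm p t r f := by
  have h0 : 0 < r := zero_lt_one.trans hr
  have h (k : DyadicIndex n) : mixedLpNorm p ((dyadicCube k).indicator (a • f)) =
      ‖a‖ₑ * mixedLpNorm p ((dyadicCube k).indicator f) := by
    rw [mixedLpNorm, mixedLpNorm, ← mixedNorm_const_mul p hp _ enorm_ne_top]
    congr 1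
    funext x
    by_cases hk : x ∈ dyadicCube k <;> simp [hk, enorm_mul]
  simp_rw [bmNorm, h, ENNReal.mul_rpow_of_nonneg _ _ h0.le]
  simp_rw [mul_left_comm _ (‖a‖ₑ ^ r)]
  rw [ENNReal.tsum_mul_left, ENNReal.mul_rpow_of_nonneg _ _ (one_div_nonneg.2 h0.le),
    ← ENNReal.rpow_mul, mul_one_div_cancel h0.ne', ENNReal.rpow_one]

theorem ae_eq_zero_of_bmNorm {n : ℕ} (p : Fin n → ℝ) (hp : ∀ i, 1 < p i) (t r : ℝ) (hr : 1 < r)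
    {f : (Fin n → ℝ) → ℂ} (hf : Measurable f) (h : bmNorm p t r f = 0) : ∀ᵐ x, f x = 0 := by
  have h0 : 0 < r := zero_lt_one.trans hr
  rw [bmNorm, ENNReal.rpow_eq_zero_iff_of_pos (one_div_pos.2 h0), ENNReal.tsum_eq_zero] at h
  have hk (k : DyadicIndex n) : ∀ᵐ x, (dyadicCube k).indicator f x = 0 := by
    have hv : volume (dyadicCube k) ^ (r / t - r / n * ∑ i, 1 / p i) ≠ 0 := by
      refine (ENNReal.rpow_pos ?_ ?_).ne'
      · rw [volume_dyadicCube]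
        exact ENNReal.pow_pos (ENNReal.ofReal_pos.2 (by positivity)) n
      · rw [volume_dyadicCube]
        exact ENNReal.pow_ne_top ENNReal.ofReal_ne_top
    have h1 := (mul_eq_zero.1 (h k)).resolve_left hv
    rw [ENNReal.rpow_eq_zero_iff_of_pos h0] at h1
    have h2 := ae_eq_zero_of_mixedNorm p hp (hf.indicator (measurableSet_dyadicCube k)).enorm h1
    filter_upwards [h2] with x hx
    simpa using hx
  filter_upwards [ae_all_iff.2 hk] with x hx
  have h3 := hx (0, fun i => ⌊x i⌋)
  rwa [Set.indicator_of_mem] at h3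
  intro i _
  simp [Int.floor_le, Int.lt_floor_add_one]

/-- The mixed Bourgain–Morrey space `M_p^{t,r}` on `ℝⁿ`: measurable functions of finite norm, with
functions that agree almost everywhere identified. -/
def bmSpace {n : ℕ} (p : Fin n → ℝ) (t r : ℝ) (hp : ∀ i, 1 < p i) (hr : 1 < r) :
    Submodule ℂ ((Fin n → ℝ) →ₘ[volume] ℂ) where
  carrier := {f | bmNorm p t r f < ∞}
  zero_mem' := by
    have h : bmNorm p t r ((0 : (Fin n → ℝ) →ₘ[volume] ℂ) : (Fin n → ℝ) → ℂ) =
        bmNorm p t r ((0 : ℂ) • (0 : (Fin n → ℝ) → ℂ)) := by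
      refine bmNorm_congr p hp t r hr ?_
      rw [zero_smul]
      exact AEEqFun.coeFn_zero
    rw [Set.mem_ofPred_eq, h, bmNorm_smul p hp t r hr]
    simp
  add_mem' {f g} hf hg := by
    rw [Set.mem_ofPred_eq, bmNorm_congr p hp t r hr (AEEqFun.coeFn_add f g)]
    exact (bmNorm_add_le p hp t r hr f.measurable g.measurable).trans_lt
      (ENNReal.add_lt_top.2 ⟨hf, hg⟩)
  smul_mem' a f hf := by
    rw [Set.mem_ofPred_eq, bmNorm_congr p hp t r hr (AEEqFun.coeFn_smul a f),
      bmNorm_smul p hp t r hr]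
    exact ENNReal.mul_lt_top enorm_lt_top hf

section

variable {n : ℕ} {p : Fin n → ℝ} {t r : ℝ} {hp : ∀ i, 1 < p i} {hr : 1 < r}

instance : Norm (bmSpace p t r hp hr) where
  norm f := (bmNorm p t r (f : (Fin n → ℝ) →ₘ[volume] ℂ)).toReal

theorem norm_def (f : bmSpace p t r hp hr) :
    ‖f‖ = (bmNorm p t r (f : (Fin n → ℝ) →ₘ[volume] ℂ)).toReal := rfl

theorem bmSpace_core : NormedSpace.Core ℂ (bmSpace p t r hp hr) where
  norm_nonneg _ := ENNReal.toReal_nonneg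
  norm_smul a f := by
    rw [norm_def, norm_def, Submodule.coe_smul, bmNorm_congr p hp t r hr (AEEqFun.coeFn_smul a f.1),
      bmNorm_smul p hp t r hr]
    simp
  norm_triangle f g := by
    rw [norm_def, norm_def, norm_def, Submodule.coe_add,
      bmNorm_congr p hp t r hr (AEEqFun.coeFn_add f.1 g.1), ← ENNReal.toReal_add f.2.ne g.2.ne]
    exact ENNReal.toReal_mono (ENNReal.add_lt_top.2 ⟨f.2, g.2⟩).ne
      (bmNorm_add_le p hp t r hr f.1.measurable g.1.measurable)
  norm_eq_zero_iff f := by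
    constructor
    · intro h
      rw [norm_def, ENNReal.toReal_eq_zero_iff] at h
      have h1 := ae_eq_zero_of_bmNorm p hp t r hr f.1.measurable (h.resolve_right f.2.ne)
      refine Subtype.ext (AEEqFun.ext ?_)
      refine Filter.EventuallyEq.trans h1 ?_
      exact (AEEqFun.coeFn_zero (α := Fin n → ℝ) (μ := volume) (β := ℂ)).symm
    · rintro rfl
      have h : bmNorm p t r ((0 : (Fin n → ℝ) →ₘ[volume] ℂ) : (Fin n → ℝ) → ℂ) =
          bmNorm p t r ((0 : ℂ) • (0 : (Fin n → ℝ) → ℂ)) := by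
        refine bmNorm_congr p hp t r hr ?_
        rw [zero_smul]
        exact AEEqFun.coeFn_zero
      rw [norm_def, Submodule.coe_zero, h, bmNorm_smul p hp t r hr]
      simp

instance : NormedAddCommGroup (bmSpace p t r hp hr) :=
  NormedAddCommGroup.ofCore bmSpace_core

instance : NormedSpace ℂ (bmSpace p t r hp hr) :=
  NormedSpace.ofCore bmSpace_core

end

end MixedBourgainMorrey

end

noncomputable section

namespace MixedBourgainMorrey

open Filter Topology

/-! Write `w_Q = |Q|^{1/t - (1/n) ∑ 1/pᵢ}`. The Bourgain–Morrey norm is exactly the `ℓ^r` norm over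
dyadic cubes of the mixed Lebesgue norms of `w_Q f χ_Q`, so `f ↦ (w_Q f χ_Q)_Q` is an isometric
embedding `J` of the space into `ℓ^r(L^p)` (`bmEmbedding`). The dual of `ℓ^r(L^p)` is
`ℓ^{r'}(L^{p'})` (`mixedPairing_surjective`, `exists_dualPairing_eq`). By Hahn–Banach every
functional on the Bourgain–Morrey space therefore comes from a family `h = (h_Q)` of no larger norm
(`exists_seqPairing_bmEmbedding_eq`). Interchanging sum and integral turns `∑ ∫ (w_Q f χ_Q) h_Q`
into `∫ f g` with `g = ∑ w_Q χ_Q h_Q` (`IsSynthesis`).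

Up to normalisation `w_Q χ_Q h_Q` is a block with coefficient `‖h_Q‖`, so the block expansions of
`g` are the families `h` synthesising `g`, and the block norm is the least norm of such a family.
Hölder's inequality gives `‖L_g‖ ≤ ‖g‖`. The opposite inequality comes from the Hahn–Banach family,
once `g` is known to be determined by its functional. Uniqueness
(`aeEqFun_eq_of_forall_integral_mul_eq`) and the almost everywhere convergence of the synthesis
(`exists_isSynthesis`) are both obtained by testing on unit cubes. Their indicators lie in the space
because `n / ∑ 1/pᵢ < t < r` (`bmNorm_unitCube_lt_top`).

For reflexivity, a bidual element composed with the surjection from `ℓ^{r'}(L^{p'})` onto the dual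
is represented by some `F` in `ℓ^r(L^p)`. As the composition kills the kernel of that surjection,
each `F_Q` lives on `Q` and the functions `F_Q / w_Q` agree on overlaps. They glue to one function
`f` with `J f = F`. -/

/-! ### Mixed norms: Hölder's inequality, limit theorems and the extremal function. -/

theorem mixedNorm_congr {n : ℕ} (p : Fin n → ℝ) (hp : ∀ i, 1 < p i) {F G : (Fin n → ℝ) → ℝ≥0∞}
    (h : F =ᵐ[volume] G) : mixedNorm p F = mixedNorm p G :=
  le_antisymm (mixedNorm_mono p hp h.le) (mixedNorm_mono p hp h.symm.le)

theorem lintegral_eq_of_fin_zero (F : (Fin 0 → ℝ) → ℝ≥0∞) : ∫⁻ z, F z = F Fin.elim0 := by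
  have : volume (Set.univ : Set (Fin 0 → ℝ)) = 1 := by
    simp [volume_pi]
  rw [lintegral_unique, this, mul_one]
  exact congrArg F (Subsingleton.elim _ _)

theorem lintegral_cons {n : ℕ} {F : (Fin (n + 1) → ℝ) → ℝ≥0∞} (hF : Measurable F) :
    ∫⁻ z, F z = ∫⁻ y : Fin n → ℝ, ∫⁻ x : ℝ, F (Fin.cons x y) := by
  have e := (volume_preserving_piFinSuccAbove (fun _ : Fin (n + 1) => ℝ) 0).symm
  have h1 := (Measure.measurePreserving_swap (μ := (volume : Measure (Fin n → ℝ)))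
    (ν := (volume : Measure ℝ)))
  rw [← (e.comp h1).lintegral_comp hF]
  refine (lintegral_prod _ ?_).trans ?_
  · exact (hF.comp (e.comp h1).measurable).aemeasurable
  · simp [MeasurableEquiv.piFinSuccAbove_symm_apply, Fin.insertNthEquiv]

theorem ae_lt_top_of_mixedNorm {n : ℕ} (p : Fin n → ℝ) (hp : ∀ i, 1 < p i)
    {F : (Fin n → ℝ) → ℝ≥0∞} (hF : Measurable F) (h : mixedNorm p F ≠ ∞) : ∀ᵐ x, F x < ∞ := by
  induction n with
  | zero =>
    refine Eventually.of_forall fun x => ?_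
    rw [Subsingleton.elim x Fin.elim0]
    exact lt_top_iff_ne_top.2 h
  | succ n ih =>
    have h0 : 0 < p 0 := zero_lt_one.trans (hp 0)
    refine ae_of_ae_ae_cons (hF measurableSet_Iio) ?_
    filter_upwards [ih (Fin.tail p) (fun i => hp i.succ) (measurable_inner _ hF) h] with y hy
    have hm : Measurable fun x : ℝ => F (Fin.cons x y) ^ p 0 :=
      ((measurable_section hF).comp measurable_prodMk_left).pow_const _
    rw [ENNReal.rpow_lt_top_iff_of_pos (one_div_pos.2 h0)] at hy
    filter_upwards [ae_lt_top hm hy.ne] with x hx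
    exact (ENNReal.rpow_lt_top_iff_of_pos h0).1 hx

/-- One-variable Hölder in the innermost variable; the inner norms of `F` and `G` then carry the
induction. -/
theorem lintegral_mul_le_mixedNorm {n : ℕ} (p q : Fin n → ℝ)
    (hpq : ∀ i, (p i).HolderConjugate (q i)) {F G : (Fin n → ℝ) → ℝ≥0∞}
    (hF : Measurable F) (hG : Measurable G) :
    ∫⁻ x, F x * G x ≤ mixedNorm p F * mixedNorm q G := by
  induction n with
  | zero => rw [lintegral_eq_of_fin_zero]; rfl
  | succ n ih =>
    refine (lintegral_cons (hF.mul hG)).trans_le ?_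
    refine le_trans (lintegral_mono fun y => ?_)
      (ih (Fin.tail p) (Fin.tail q) (fun i => hpq i.succ) (measurable_inner (p 0) hF)
        (measurable_inner (q 0) hG))
    exact ENNReal.lintegral_mul_le_Lp_mul_Lq volume (hpq 0)
      ((measurable_section hF).comp measurable_prodMk_left).aemeasurable
      ((measurable_section hG).comp measurable_prodMk_left).aemeasurable

/-- Dominated convergence, one variable at a time. The index runs along a general filter because
`Finset ℕ` is needed for countable additivity in `hasSum_dual_indicator_decay`. -/
theorem tendsto_mixedNorm_zero {ι : Type*} [Countable ι] {l : Filter ι}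
    [l.IsCountablyGenerated] {n : ℕ} (p : Fin n → ℝ) (hp : ∀ i, 1 < p i) {F : ι → (Fin n → ℝ) → ℝ≥0∞} {G : (Fin n → ℝ) → ℝ≥0∞}
    (hF : ∀ i, Measurable (F i)) (hG : Measurable G) (hFG : ∀ i, ∀ᵐ x, F i x ≤ G x)
    (h : mixedNorm p G ≠ ∞) (hlim : ∀ᵐ x, Tendsto (fun i => F i x) l (𝓝 0)) :
    Tendsto (fun i => mixedNorm p (F i)) l (𝓝 0) := by
  induction n with
  | zero =>
    obtain ⟨x, hx⟩ := hlim.exists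
    rw [Subsingleton.elim x Fin.elim0] at hx
    exact hx
  | succ n ih =>
    have h0 : 0 < p 0 := zero_lt_one.trans (hp 0)
    refine ih (Fin.tail p) (fun i => hp i.succ) (fun i => measurable_inner (p 0) (hF i))
      (measurable_inner (p 0) hG) (fun i => ?_) h ?_
    · filter_upwards [ae_ae_cons (hFG i)] with y hy
      refine ENNReal.rpow_le_rpow (lintegral_mono_ae ?_) (one_div_nonneg.2 h0.le)
      filter_upwards [hy] with x hx
      exact ENNReal.rpow_le_rpow hx h0.le
    -- Finiteness of the mixed norm of `G` makes its inner integral finite on almost every line,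
    -- which supplies an integrable dominating function there.
    · filter_upwards [ae_ae_cons hlim, ae_all_iff.2 fun i => ae_ae_cons (hFG i),
        ae_lt_top_of_mixedNorm _ (fun i => hp i.succ) (measurable_inner (p 0) hG) h]
        with y hy1 hy2 hy3
      rw [ENNReal.rpow_lt_top_iff_of_pos (one_div_pos.2 h0)] at hy3
      have hz (a : ℝ) (ha : 0 < a) : Tendsto (fun z : ℝ≥0∞ => z ^ a) (𝓝 0) (𝓝 0) := by
        simpa [ENNReal.zero_rpow_of_pos ha] using (ENNReal.continuous_rpow_const (y := a)).tendsto 0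
      refine (hz _ (one_div_pos.2 h0)).comp ?_
      rw [← lintegral_zero (μ := (volume : Measure ℝ))]
      refine tendsto_lintegral_filter_of_dominated_convergence (fun x => G (Fin.cons x y) ^ p 0)
        (Eventually.of_forall fun i =>
          ((measurable_section (hF i)).comp measurable_prodMk_left).pow_const _)
        (Eventually.of_forall fun i => ?_) hy3.ne ?_
      · filter_upwards [hy2 i] with x hx
        exact ENNReal.rpow_le_rpow hx h0.le
      · filter_upwards [hy1] with x hx
        exact (hz _ h0).comp hx

/-- Monotone convergence, one variable at a time. It reduces the norm of an arbitrary function to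
truncations of finite norm in `mixedLpNorm_le_of_dual`. -/
theorem mixedNorm_iSup {n : ℕ} (p : Fin n → ℝ) (hp : ∀ i, 1 < p i)
    {F : ℕ → (Fin n → ℝ) → ℝ≥0∞} (hF : ∀ j, Measurable (F j)) (hmono : Monotone F) :
    mixedNorm p (fun x => ⨆ j, F j x) = ⨆ j, mixedNorm p (F j) := by
  induction n with
  | zero => rfl
  | succ n ih =>
    have h0 : 0 < p 0 := zero_lt_one.trans (hp 0)
    have hsup (a : ℝ) (ha : 0 < a) (u : ℕ → ℝ≥0∞) : (⨆ j, u j) ^ a = ⨆ j, u j ^ a :=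
      (ENNReal.orderIsoRpow a ha).map_iSup u
    simp only [mixedNorm]
    rw [← ih (Fin.tail p) (fun i => hp i.succ) (fun j => measurable_inner (p 0) (hF j))]
    · congr 1
      funext y
      simp_rw [hsup _ h0]
      rw [lintegral_iSup, hsup _ (one_div_pos.2 h0)]
      · exact fun j => ((measurable_section (hF j)).comp measurable_prodMk_left).pow_const _
      · exact fun i j hij x => ENNReal.rpow_le_rpow (hmono hij _) h0.le
    · intro i j hij y
      exact ENNReal.rpow_le_rpow (lintegral_mono fun x =>
        ENNReal.rpow_le_rpow (hmono hij _) h0.le) (one_div_nonneg.2 h0.le)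

/-- The converse of Hölder's inequality for mixed norms: the supremum in the duality formula is
attained. -/
theorem exists_lintegral_mul_eq_mixedNorm {n : ℕ} (p q : Fin n → ℝ)
    (hpq : ∀ i, (p i).HolderConjugate (q i)) {H : (Fin n → ℝ) → ℝ≥0∞} (hH : Measurable H)
    (h : mixedNorm q H ≠ ∞) :
    ∃ F : (Fin n → ℝ) → ℝ≥0∞, Measurable F ∧ mixedNorm p F ≤ 1 ∧
      ∫⁻ x, F x * H x = mixedNorm q H := by
  induction n with
  | zero =>
    refine ⟨fun _ => 1, measurable_const, le_rfl, ?_⟩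
    rw [lintegral_eq_of_fin_zero]
    exact one_mul _
  | succ n ih =>
    have hp0 : 0 < p 0 := (hpq 0).pos
    have hq0 : 0 < q 0 := (hpq 0).symm.pos
    have hq1 : 0 < q 0 - 1 := (hpq 0).symm.sub_one_pos
    set N : (Fin n → ℝ) → ℝ≥0∞ := fun y => (∫⁻ x : ℝ, H (Fin.cons x y) ^ q 0) ^ (1 / q 0) with hN
    have hNm : Measurable N := measurable_inner (q 0) hH
    have hNp (y) : N y ^ q 0 = ∫⁻ x : ℝ, H (Fin.cons x y) ^ q 0 := by
      rw [hN]
      simp only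
      rw [← ENNReal.rpow_mul, one_div_mul_cancel hq0.ne', ENNReal.rpow_one]
    obtain ⟨G, hGm, hG1, hG2⟩ := ih (Fin.tail p) (Fin.tail q) (fun i => hpq i.succ) hNm h
    have hN_top := ae_lt_top_of_mixedNorm (Fin.tail q) (fun i => (hpq i.succ).symm.lt) hNm h
    have htail : Measurable (Fin.tail : (Fin (n + 1) → ℝ) → (Fin n → ℝ)) :=
      measurable_pi_lambda _ fun j => measurable_pi_apply j.succ
    -- The extremal function is the inductive one `G` for the inner norm `N`, times the one-variable
    -- extremal `(H / N)^(q 0 - 1)` on each line. Since `(q 0 - 1) * p 0 = q 0`, the latter has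
    -- inner norm at most one.
    have hFm : Measurable fun z : Fin (n + 1) → ℝ =>
        G (Fin.tail z) * (H z / N (Fin.tail z)) ^ (q 0 - 1) :=
      (hGm.comp htail).mul ((hH.div (hNm.comp htail)).pow_const _)
    have hHy (y) : Measurable fun x : ℝ => H (Fin.cons x y) :=
      (measurable_section hH).comp measurable_prodMk_left
    refine ⟨_, hFm, (mixedNorm_mono (Fin.tail p) (fun i => (hpq i.succ).lt) ?_).trans hG1, ?_⟩
    · filter_upwards [hN_top] with y hy
      simp only [Fin.tail_cons]
      simp_rw [ENNReal.mul_rpow_of_nonneg _ _ hp0.le, ← ENNReal.rpow_mul,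
        (hpq 0).symm.sub_one_mul_conj]
      rw [lintegral_const_mul _ (((hHy y).div_const _).pow_const _),
        ENNReal.mul_rpow_of_nonneg _ _ (one_div_nonneg.2 hp0.le), ← ENNReal.rpow_mul,
        mul_one_div_cancel hp0.ne', ENNReal.rpow_one]
      refine mul_le_of_le_one_right' (ENNReal.rpow_le_one ?_ (one_div_nonneg.2 hp0.le))
      simp_rw [div_eq_mul_inv, ENNReal.mul_rpow_of_nonneg _ _ hq0.le]
      rw [lintegral_mul_const _ ((hHy y).pow_const _), ← hNp, ENNReal.inv_rpow]
      exact ENNReal.mul_inv_le_one _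
    · refine (lintegral_cons (hFm.mul hH)).trans (Eq.trans ?_ hG2)
      refine lintegral_congr_ae ?_
      filter_upwards [hN_top] with y hy
      simp only [Pi.mul_apply, Fin.tail_cons, mul_assoc]
      have hm : Measurable fun x : ℝ => (H (Fin.cons x y) / N y) ^ (q 0 - 1) * H (Fin.cons x y) :=
        (((hHy y).div_const _).pow_const _).mul (hHy y)
      rw [lintegral_const_mul _ hm]
      congr 1
      -- Where `N y = 0` the quotient is degenerate, but `H` then vanishes almost everywhere on the
      -- line and both sides are zero.
      rcases eq_or_ne (N y) 0 with h1 | h1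
      · have h2 := hNp y
        rw [h1, ENNReal.zero_rpow_of_pos hq0, eq_comm, lintegral_eq_zero_iff ((hHy y).pow_const _)]
          at h2
        rw [h1]
        simp only [h1] at hm ⊢
        rw [lintegral_eq_zero_iff hm]
        filter_upwards [h2] with x hx
        rw [Pi.zero_apply, ENNReal.rpow_eq_zero_iff_of_pos hq0] at hx
        simp [hx]
      · have h3 (x : ℝ) : (H (Fin.cons x y) / N y) ^ (q 0 - 1) * H (Fin.cons x y) =
            H (Fin.cons x y) ^ q 0 * (N y)⁻¹ ^ (q 0 - 1) := by
          rw [div_eq_mul_inv, ENNReal.mul_rpow_of_nonneg _ _ hq1.le, mul_right_comm]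
          congr 1
          conv_lhs => rw [← ENNReal.rpow_one (H (Fin.cons x y)), ← ENNReal.rpow_mul, one_mul,
            ← ENNReal.rpow_add_of_nonneg _ _ hq1.le zero_le_one]
          congr 1
          ring
        simp_rw [h3]
        rw [lintegral_mul_const _ ((hHy y).pow_const _), ← hNp, ENNReal.inv_rpow,
          ← ENNReal.rpow_neg, ← ENNReal.rpow_add _ _ h1 hy.ne]
        simp

/-! ### Product functions and a decaying weight. -/

theorem mixedNorm_prod {n : ℕ} (p : Fin n → ℝ) (hp : ∀ i, 1 < p i) (v : Fin n → ℝ → ℝ≥0∞)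
    (hv : ∀ i, Measurable (v i)) (hfin : ∀ i, ∫⁻ x, v i x ^ p i ≠ ∞) :
    mixedNorm p (fun x => ∏ i, v i (x i)) = ∏ i, (∫⁻ x, v i x ^ p i) ^ (1 / p i) := by
  induction n with
  | zero => simp [mixedNorm]
  | succ n ih =>
    have h0 : 0 < p 0 := zero_lt_one.trans (hp 0)
    rw [Fin.prod_univ_succ]
    have := ih (Fin.tail p) (fun i => hp i.succ) (fun i => v i.succ) (fun i => hv i.succ)
      (fun i => hfin i.succ)
    simp only [Fin.tail] at this
    rw [← this, ← mixedNorm_const_mul (Fin.tail p) (fun i => hp i.succ) _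
      (ENNReal.rpow_ne_top_of_nonneg (one_div_nonneg.2 h0.le) (hfin 0))]
    simp only [mixedNorm, Fin.prod_univ_succ, Fin.cons_zero, Fin.cons_succ]
    congr 1
    funext y
    simp_rw [ENNReal.mul_rpow_of_nonneg _ _ h0.le]
    rw [lintegral_mul_const _ ((hv 0).pow_const _),
      ENNReal.mul_rpow_of_nonneg _ _ (one_div_nonneg.2 h0.le), ← ENNReal.rpow_mul,
      mul_one_div_cancel h0.ne', ENNReal.rpow_one]

/-- A strictly positive function on `ℝⁿ` that lies in every mixed Lebesgue space with exponents
larger than one. -/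
def decay {n : ℕ} (x : Fin n → ℝ) : ℝ := ∏ i, (1 + ‖x i‖)⁻¹

theorem decay_pos {n : ℕ} (x : Fin n → ℝ) : 0 < decay x :=
  Finset.prod_pos fun i _ => by positivity

theorem measurable_decay {n : ℕ} : Measurable (decay : (Fin n → ℝ) → ℝ) := by
  unfold decay
  fun_prop

/-- The norm factors over the coordinates, and `(1 + |x|)^(-p i)` is integrable on the line because
`1 < p i`. -/
theorem mixedNorm_decay {n : ℕ} (p : Fin n → ℝ) (hp : ∀ i, 1 < p i) :
    mixedNorm p (fun x => ENNReal.ofReal (decay x)) < ∞ := by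
  have hv (i) : ∫⁻ x : ℝ, ENNReal.ofReal (1 + ‖x‖)⁻¹ ^ p i < ∞ := by
    have h : Integrable (fun x : ℝ => (1 + ‖x‖) ^ (-p i)) :=
      integrable_one_add_norm (by simpa using hp i)
    refine lt_of_eq_of_lt (lintegral_congr fun x => ?_) h.lintegral_lt_top
    have : 0 < 1 + ‖x‖ := by positivity
    rw [ENNReal.ofReal_rpow_of_nonneg (by positivity) (zero_lt_one.trans (hp i)).le,
      Real.rpow_neg this.le, Real.inv_rpow this.le]
  have h := mixedNorm_prod p hp (fun _ x => ENNReal.ofReal (1 + ‖x‖)⁻¹)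
    (fun _ => by fun_prop) (fun i => (hv i).ne)
  have h2 : (fun x : Fin n → ℝ => ENNReal.ofReal (decay x)) =
      fun x => ∏ i, ENNReal.ofReal (1 + ‖x i‖)⁻¹ := by
    funext x
    exact ENNReal.ofReal_prod_of_nonneg fun i _ => by positivity
  rw [h2, h]
  exact ENNReal.prod_lt_top fun i _ =>
    ENNReal.rpow_lt_top_of_nonneg (one_div_nonneg.2 (zero_lt_one.trans (hp i)).le) (hv i).ne

/-! ### The mixed Lebesgue space as a normed space. -/

theorem mixedLpNorm_mono {n : ℕ} (p : Fin n → ℝ) (hp : ∀ i, 1 < p i) {f g : (Fin n → ℝ) → ℂ}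
    (h : ∀ᵐ x, ‖f x‖ₑ ≤ ‖g x‖ₑ) : mixedLpNorm p f ≤ mixedLpNorm p g :=
  mixedNorm_mono p hp h

theorem mixedLpNorm_congr {n : ℕ} (p : Fin n → ℝ) (hp : ∀ i, 1 < p i) {f g : (Fin n → ℝ) → ℂ}
    (h : f =ᵐ[volume] g) : mixedLpNorm p f = mixedLpNorm p g :=
  mixedNorm_congr p hp (h.fun_comp _)

theorem mixedLpNorm_smul {n : ℕ} (p : Fin n → ℝ) (hp : ∀ i, 1 < p i) (a : ℂ)
    (f : (Fin n → ℝ) → ℂ) : mixedLpNorm p (a • f) = ‖a‖ₑ * mixedLpNorm p f := by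
  rw [mixedLpNorm, mixedLpNorm, ← mixedNorm_const_mul p hp _ enorm_ne_top]
  simp [enorm_mul]

theorem mixedLpNorm_zero {n : ℕ} (p : Fin n → ℝ) (hp : ∀ i, 1 < p i) :
    mixedLpNorm p (0 : (Fin n → ℝ) → ℂ) = 0 := by
  simpa using mixedLpNorm_smul p hp 0 0

/-- The mixed Lebesgue space on `ℝⁿ`. -/
def mixedLp {n : ℕ} (p : Fin n → ℝ) (hp : ∀ i, 1 < p i) :
    Submodule ℂ ((Fin n → ℝ) →ₘ[volume] ℂ) where
  carrier := {f | mixedLpNorm p f < ∞}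
  zero_mem' := by
    rw [Set.mem_ofPred_eq, mixedLpNorm_congr p hp AEEqFun.coeFn_zero, mixedLpNorm_zero p hp]
    simp
  add_mem' {f g} hf hg := by
    rw [Set.mem_ofPred_eq, mixedLpNorm_congr p hp (AEEqFun.coeFn_add f g)]
    exact (mixedLpNorm_add_le p hp f.measurable g.measurable).trans_lt
      (ENNReal.add_lt_top.2 ⟨hf, hg⟩)
  smul_mem' a f hf := by
    rw [Set.mem_ofPred_eq, mixedLpNorm_congr p hp (AEEqFun.coeFn_smul a f),
      mixedLpNorm_smul p hp]
    exact ENNReal.mul_lt_top enorm_lt_top hf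

/-- Membership of a function in the mixed Lebesgue space. -/
def MemMixedLp {n : ℕ} (p : Fin n → ℝ) (f : (Fin n → ℝ) → ℂ) : Prop :=
  AEStronglyMeasurable f volume ∧ mixedLpNorm p f < ∞

section

variable {n : ℕ} {p : Fin n → ℝ} {hp : ∀ i, 1 < p i}

instance : Norm (mixedLp p hp) where
  norm f := (mixedLpNorm p (f : (Fin n → ℝ) →ₘ[volume] ℂ)).toReal

theorem mixedLp_norm_def (f : mixedLp p hp) :
    ‖f‖ = (mixedLpNorm p (f : (Fin n → ℝ) →ₘ[volume] ℂ)).toReal := rfl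

theorem mixedLp_core : NormedSpace.Core ℂ (mixedLp p hp) where
  norm_nonneg _ := ENNReal.toReal_nonneg
  norm_smul a f := by
    rw [mixedLp_norm_def, mixedLp_norm_def, Submodule.coe_smul,
      mixedLpNorm_congr p hp (AEEqFun.coeFn_smul a f.1), mixedLpNorm_smul p hp]
    simp
  norm_triangle f g := by
    rw [mixedLp_norm_def, mixedLp_norm_def, mixedLp_norm_def, Submodule.coe_add,
      mixedLpNorm_congr p hp (AEEqFun.coeFn_add f.1 g.1), ← ENNReal.toReal_add f.2.ne g.2.ne]
    exact ENNReal.toReal_mono (ENNReal.add_lt_top.2 ⟨f.2, g.2⟩).ne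
      (mixedLpNorm_add_le p hp f.1.measurable g.1.measurable)
  norm_eq_zero_iff f := by
    constructor
    · intro h
      rw [mixedLp_norm_def, ENNReal.toReal_eq_zero_iff] at h
      have h1 := ae_eq_zero_of_mixedNorm p hp f.1.measurable.enorm (h.resolve_right f.2.ne)
      refine Subtype.ext (AEEqFun.ext (EventuallyEq.trans ?_ AEEqFun.coeFn_zero.symm))
      filter_upwards [h1] with x hx
      simpa using hx
    · rintro rfl
      rw [mixedLp_norm_def, Submodule.coe_zero, mixedLpNorm_congr p hp AEEqFun.coeFn_zero,
        mixedLpNorm_zero p hp]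
      simp

instance : NormedAddCommGroup (mixedLp p hp) :=
  NormedAddCommGroup.ofCore mixedLp_core

instance : NormedSpace ℂ (mixedLp p hp) :=
  NormedSpace.ofCore mixedLp_core

theorem enorm_mixedLp (f : mixedLp p hp) :
    ‖f‖ₑ = mixedLpNorm p (f : (Fin n → ℝ) →ₘ[volume] ℂ) := by
  rw [← ofReal_norm, mixedLp_norm_def, ENNReal.ofReal_toReal f.2.ne]

theorem mixedLp_coe_add (f g : mixedLp p hp) : (f + g).1 =ᵐ[volume] ⇑f.1 + ⇑g.1 :=
  AEEqFun.coeFn_add f.1 g.1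

theorem mixedLp_coe_sub (f g : mixedLp p hp) : (f - g).1 =ᵐ[volume] ⇑f.1 - ⇑g.1 :=
  AEEqFun.coeFn_sub f.1 g.1

theorem mixedLp_coe_smul (a : ℂ) (f : mixedLp p hp) : (a • f).1 =ᵐ[volume] a • ⇑f.1 :=
  AEEqFun.coeFn_smul a f.1

theorem mixedLp_coe_zero : (0 : mixedLp p hp).1 =ᵐ[volume] (0 : (Fin n → ℝ) → ℂ) :=
  AEEqFun.coeFn_zero

theorem memMixedLp_coe (f : mixedLp p hp) : MemMixedLp p f.1 :=
  ⟨f.1.aestronglyMeasurable, f.2⟩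

theorem MemMixedLp.mono {f g : (Fin n → ℝ) → ℂ} (hg : MemMixedLp p g) (hp : ∀ i, 1 < p i)
    (hf : AEStronglyMeasurable f volume) (h : ∀ᵐ x, ‖f x‖ₑ ≤ ‖g x‖ₑ) : MemMixedLp p f :=
  ⟨hf, (mixedLpNorm_mono p hp h).trans_lt hg.2⟩

theorem MemMixedLp.congr {f g : (Fin n → ℝ) → ℂ} (hg : MemMixedLp p g) (hp : ∀ i, 1 < p i)
    (h : f =ᵐ[volume] g) : MemMixedLp p f :=
  ⟨hg.1.congr h.symm, (mixedLpNorm_congr p hp h).trans_lt hg.2⟩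

theorem MemMixedLp.add {f g : (Fin n → ℝ) → ℂ} (hp : ∀ i, 1 < p i) (hf : MemMixedLp p f)
    (hg : MemMixedLp p g) : MemMixedLp p (f + g) := by
  refine ⟨hf.1.add hg.1, ?_⟩
  obtain ⟨f', hf', hff'⟩ := hf.1
  obtain ⟨g', hg', hgg'⟩ := hg.1
  have h1 := hf.2
  have h2 := hg.2
  rw [mixedLpNorm_congr p hp hff'] at h1
  rw [mixedLpNorm_congr p hp hgg'] at h2
  rw [mixedLpNorm_congr p hp (hff'.add hgg')]
  exact (mixedLpNorm_add_le p hp hf'.measurable hg'.measurable).trans_lt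
    (ENNReal.add_lt_top.2 ⟨h1, h2⟩)

theorem MemMixedLp.smul {f : (Fin n → ℝ) → ℂ} (hp : ∀ i, 1 < p i) (a : ℂ) (hf : MemMixedLp p f) :
    MemMixedLp p (a • f) := by
  refine ⟨hf.1.const_smul a, ?_⟩
  rw [mixedLpNorm_smul p hp]
  exact ENNReal.mul_lt_top enorm_lt_top hf.2

theorem MemMixedLp.zero (hp : ∀ i, 1 < p i) : MemMixedLp p 0 :=
  ⟨aestronglyMeasurable_zero, by rw [mixedLpNorm_zero p hp]; exact ENNReal.zero_lt_top⟩

theorem memMixedLp_decay (hp : ∀ i, 1 < p i) : MemMixedLp p (fun x => (decay x : ℂ)) := by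
  refine ⟨(Complex.measurable_ofReal.comp measurable_decay).aestronglyMeasurable, ?_⟩
  refine lt_of_eq_of_lt ?_ (mixedNorm_decay p hp)
  rw [mixedLpNorm]
  congr 1
  funext x
  rw [← ofReal_norm, Complex.norm_real, Real.norm_of_nonneg (decay_pos x).le]

open Classical in
variable (p hp) in
/-- The element of the mixed Lebesgue space given by a function, and zero for functions that do not
belong to it. -/
def toMixedLp (f : (Fin n → ℝ) → ℂ) : mixedLp p hp :=
  if h : MemMixedLp p f then
    ⟨AEEqFun.mk f h.1, (mixedLpNorm_congr p hp (AEEqFun.coeFn_mk f h.1)).trans_lt h.2⟩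
  else 0

theorem coe_toMixedLp {f : (Fin n → ℝ) → ℂ} (h : MemMixedLp p f) :
    (toMixedLp p hp f).1 =ᵐ[volume] f := by
  rw [toMixedLp, dif_pos h]
  exact AEEqFun.coeFn_mk f h.1

theorem mixedLp_ext {f g : mixedLp p hp} (h : f.1 =ᵐ[volume] g.1) : f = g :=
  Subtype.ext (AEEqFun.ext h)

theorem toMixedLp_coe (f : mixedLp p hp) : toMixedLp p hp f.1 = f :=
  mixedLp_ext (coe_toMixedLp (memMixedLp_coe f))

theorem toMixedLp_add {f g : (Fin n → ℝ) → ℂ} (hf : MemMixedLp p f) (hg : MemMixedLp p g) :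
    toMixedLp p hp (f + g) = toMixedLp p hp f + toMixedLp p hp g :=
  mixedLp_ext ((coe_toMixedLp (hf.add hp hg)).trans
    (((coe_toMixedLp hf).add (coe_toMixedLp hg)).symm.trans (mixedLp_coe_add _ _).symm))

theorem toMixedLp_smul (a : ℂ) {f : (Fin n → ℝ) → ℂ} (hf : MemMixedLp p f) :
    toMixedLp p hp (a • f) = a • toMixedLp p hp f :=
  mixedLp_ext ((coe_toMixedLp (hf.smul hp a)).trans
    (((coe_toMixedLp hf).const_smul a).symm.trans (mixedLp_coe_smul _ _).symm))

theorem toMixedLp_congr {f g : (Fin n → ℝ) → ℂ} (hg : MemMixedLp p g) (h : f =ᵐ[volume] g) :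
    toMixedLp p hp f = toMixedLp p hp g :=
  mixedLp_ext ((coe_toMixedLp (hg.congr hp h)).trans (h.trans (coe_toMixedLp hg).symm))

theorem toMixedLp_zero : toMixedLp p hp 0 = 0 :=
  mixedLp_ext ((coe_toMixedLp (MemMixedLp.zero hp)).trans mixedLp_coe_zero.symm)

theorem toMixedLp_sum {ι : Type*} (s : Finset ι) {f : ι → (Fin n → ℝ) → ℂ}
    (hf : ∀ i, MemMixedLp p (f i)) :
    MemMixedLp p (∑ i ∈ s, f i) ∧
      toMixedLp p hp (∑ i ∈ s, f i) = ∑ i ∈ s, toMixedLp p hp (f i) := by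
  classical
  induction s using Finset.induction_on with
  | empty => simpa using ⟨MemMixedLp.zero hp, toMixedLp_zero⟩
  | insert i s hi ih =>
    rw [Finset.sum_insert hi, Finset.sum_insert hi]
    exact ⟨(hf i).add hp ih.1, by rw [toMixedLp_add (hf i) ih.1, ih.2]⟩

theorem enorm_toMixedLp {f : (Fin n → ℝ) → ℂ} (h : MemMixedLp p f) :
    ‖toMixedLp p hp f‖ₑ = mixedLpNorm p f := by
  rw [enorm_mixedLp, mixedLpNorm_congr p hp (coe_toMixedLp h)]

/-- Dominated convergence in mixed Lebesgue spaces. -/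
theorem tendsto_toMixedLp {ι : Type*} [Countable ι] {l : Filter ι} [l.IsCountablyGenerated]
    [l.NeBot] {f : ι → (Fin n → ℝ) → ℂ} {f₀ g : (Fin n → ℝ) → ℂ} (hg : MemMixedLp p g)
    (hf : ∀ i, AEStronglyMeasurable (f i) volume) (hf₀ : AEStronglyMeasurable f₀ volume)
    (hfg : ∀ i, ∀ᵐ x, ‖f i x‖ₑ ≤ ‖g x‖ₑ) (hlim : ∀ᵐ x, Tendsto (fun i => f i x) l (𝓝 (f₀ x))) :
    Tendsto (fun i => toMixedLp p hp (f i)) l (𝓝 (toMixedLp p hp f₀)) := by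
  have hfi (i) : MemMixedLp p (f i) := hg.mono hp (hf i) (hfg i)
  have h0g : ∀ᵐ x, ‖f₀ x‖ₑ ≤ ‖g x‖ₑ := by
    filter_upwards [hlim, ae_all_iff.2 hfg] with x hx1 hx2
    exact le_of_tendsto hx1.enorm (Eventually.of_forall hx2)
  have hf0 : MemMixedLp p f₀ := hg.mono hp hf₀ h0g
  rw [tendsto_iff_edist_tendsto_0]
  simp_rw [edist_eq_enorm_sub, enorm_mixedLp]
  have hsub (i) : (toMixedLp p hp (f i) - toMixedLp p hp f₀).1 =ᵐ[volume] f i - f₀ :=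
    (mixedLp_coe_sub _ _).trans ((coe_toMixedLp (hfi i)).sub (coe_toMixedLp hf0))
  have h2 := hg.add hp hg
  -- The dominating function must be measurable, not just almost everywhere so, hence the chosen
  -- representative of `g + g` replaces `g`. It is more than large enough to bound `‖f i‖ + ‖f₀‖`.
  refine tendsto_mixedNorm_zero p hp (G := fun x => ‖(toMixedLp p hp (g + g)).1 x‖ₑ +
      ‖(toMixedLp p hp (g + g)).1 x‖ₑ)
    (fun i => (AEEqFun.measurable _).enorm)
    ((AEEqFun.measurable _).enorm.add (AEEqFun.measurable _).enorm) (fun i => ?_) ?_ ?_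
  · filter_upwards [hsub i, coe_toMixedLp (hp := hp) h2, hfg i, h0g] with x h3 h4 h5 h6
    rw [h3, h4]
    have h7 : ‖g x‖ₑ ≤ ‖(g + g) x‖ₑ := by
      rw [Pi.add_apply, ← two_mul, enorm_mul]
      refine le_mul_of_one_le_left' ?_
      rw [← ofReal_norm]
      simp
    exact enorm_sub_le.trans (add_le_add (h5.trans h7) (h6.trans h7))
  · refine ((mixedNorm_add_le p hp (AEEqFun.measurable _).enorm
      (AEEqFun.measurable _).enorm).trans_lt (ENNReal.add_lt_top.2 ⟨?_, ?_⟩)).ne <;>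
    exact (toMixedLp p hp (g + g)).2
  · filter_upwards [hlim, ae_all_iff.2 hsub] with x h3 h4
    simp_rw [h4]
    have := (h3.sub_const (f₀ x)).enorm
    simpa using this

end

/-! ### The integral pairing of conjugate mixed Lebesgue spaces. -/

section

variable {n : ℕ} {p q : Fin n → ℝ}

theorem lintegral_enorm_mul_le (hpq : ∀ i, (p i).HolderConjugate (q i)) {f h : (Fin n → ℝ) → ℂ}
    (hf : AEStronglyMeasurable f volume) (hh : AEStronglyMeasurable h volume) :
    ∫⁻ x, ‖f x * h x‖ₑ ≤ mixedLpNorm p f * mixedLpNorm q h := by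
  obtain ⟨f', hf', hff'⟩ := hf
  obtain ⟨h', hh', hhh'⟩ := hh
  rw [mixedLpNorm_congr p (fun i => (hpq i).lt) hff',
    mixedLpNorm_congr q (fun i => (hpq i).symm.lt) hhh']
  refine le_trans (le_of_eq (lintegral_congr_ae ?_))
    (lintegral_mul_le_mixedNorm p q hpq hf'.measurable.enorm hh'.measurable.enorm)
  filter_upwards [hff', hhh'] with x h1 h2
  rw [h1, h2, enorm_mul]

theorem MemMixedLp.integrable_mul (hpq : ∀ i, (p i).HolderConjugate (q i))
    {f h : (Fin n → ℝ) → ℂ} (hf : MemMixedLp p f) (hh : MemMixedLp q h) :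
    Integrable (fun x => f x * h x) :=
  ⟨hf.1.mul hh.1, (lintegral_enorm_mul_le hpq hf.1 hh.1).trans_lt
    (ENNReal.mul_lt_top hf.2 hh.2)⟩

/-- The integral pairing between mixed Lebesgue spaces with conjugate exponents, as a bilinear
map. -/
def mixedPairingLinear (hp : ∀ i, 1 < p i) (hq : ∀ i, 1 < q i)
    (hpq : ∀ i, (p i).HolderConjugate (q i)) :
    mixedLp q hq →ₗ[ℂ] mixedLp p hp →ₗ[ℂ] ℂ :=
  have hi (h : mixedLp q hq) (f : mixedLp p hp) : Integrable fun x => f.1 x * h.1 x :=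
    (memMixedLp_coe f).integrable_mul hpq (memMixedLp_coe h)
  LinearMap.mk₂ ℂ (fun h f => ∫ x, f.1 x * h.1 x)
    (fun h k f => by
      rw [← integral_add (hi h f) (hi k f)]
      refine integral_congr_ae ?_
      filter_upwards [mixedLp_coe_add h k] with x hx
      rw [hx, Pi.add_apply, mul_add])
    (fun a h f => by
      rw [← integral_smul]
      refine integral_congr_ae ?_
      filter_upwards [mixedLp_coe_smul a h] with x hx
      rw [hx, Pi.smul_apply, mul_smul_comm])
    (fun h f g => by
      rw [← integral_add (hi h f) (hi h g)]
      refine integral_congr_ae ?_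
      filter_upwards [mixedLp_coe_add f g] with x hx
      rw [hx, Pi.add_apply, add_mul])
    (fun a h f => by
      rw [← integral_smul]
      refine integral_congr_ae ?_
      filter_upwards [mixedLp_coe_smul a f] with x hx
      rw [hx, Pi.smul_apply, smul_mul_assoc])

theorem norm_mixedPairingLinear_le (hp : ∀ i, 1 < p i) (hq : ∀ i, 1 < q i)
    (hpq : ∀ i, (p i).HolderConjugate (q i)) (h : mixedLp q hq) (f : mixedLp p hp) :
    ‖mixedPairingLinear hp hq hpq h f‖ ≤ 1 * ‖h‖ * ‖f‖ := by
  rw [mixedPairingLinear, LinearMap.mk₂_apply, one_mul, mul_comm, mixedLp_norm_def,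
    mixedLp_norm_def, ← ENNReal.toReal_mul]
  refine (norm_integral_le_lintegral_norm _).trans (ENNReal.toReal_mono
    (ENNReal.mul_lt_top f.2 h.2).ne ?_)
  simp_rw [ofReal_norm]
  exact lintegral_enorm_mul_le hpq (memMixedLp_coe f).1 (memMixedLp_coe h).1

/-- The integral pairing between mixed Lebesgue spaces with conjugate exponents. -/
def mixedPairing (hp : ∀ i, 1 < p i) (hq : ∀ i, 1 < q i)
    (hpq : ∀ i, (p i).HolderConjugate (q i)) :
    mixedLp q hq →L[ℂ] mixedLp p hp →L[ℂ] ℂ :=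
  LinearMap.mkContinuous₂ (mixedPairingLinear hp hq hpq) 1
    (norm_mixedPairingLinear_le hp hq hpq)

theorem mixedPairing_apply (hp : ∀ i, 1 < p i) (hq : ∀ i, 1 < q i)
    (hpq : ∀ i, (p i).HolderConjugate (q i)) (h : mixedLp q hq) (f : mixedLp p hp) :
    mixedPairing hp hq hpq h f = ∫ x, f.1 x * h.1 x := rfl

theorem norm_mixedPairing_le (hp : ∀ i, 1 < p i) (hq : ∀ i, 1 < q i)
    (hpq : ∀ i, (p i).HolderConjugate (q i)) : ‖mixedPairing hp hq hpq‖ ≤ 1 :=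
  LinearMap.mkContinuous₂_norm_le _ zero_le_one (norm_mixedPairingLinear_le hp hq hpq)

/-- The witness is `conj h / |h|`. At zeros of `h` division by zero makes it `0`, hence the bound `≤
1` rather than equality. -/
theorem exists_unimodular_mul_eq_norm {α : Type*} [MeasurableSpace α] {h : α → ℂ}
    (hh : Measurable h) :
    ∃ s : α → ℂ, Measurable s ∧ (∀ x, ‖s x‖ₑ ≤ 1) ∧ ∀ x, s x * h x = ‖h x‖ := by
  refine ⟨fun x => (starRingEnd ℂ) (h x) / ‖h x‖, ?_, fun x => ?_, fun x => ?_⟩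
  · exact (Complex.continuous_conj.measurable.comp hh).div
      (Complex.measurable_ofReal.comp hh.norm)
  · rw [← ofReal_norm, ENNReal.ofReal_le_one]
    simpa using div_self_le_one ‖h x‖
  · rcases eq_or_ne (h x) 0 with h0 | h0
    · simp [h0]
    · have : (‖h x‖ : ℂ) ≠ 0 := by simpa using h0
      field_simp
      rw [mul_comm, Complex.mul_conj, Complex.normSq_eq_norm_sq]
      push_cast
      ring

/-- The factor `s` removes the phase of `h`, leaving the nonnegative integrand `F ‖h‖`. No
integrability is assumed: if the lower integral is infinite, both sides are zero by convention. -/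
theorem integral_toReal_mul_unimodular {α : Type*} [MeasurableSpace α] {μ : Measure α}
    {F : α → ℝ≥0∞} (hF : Measurable F) (hF_top : ∀ᵐ x ∂μ, F x < ∞) {h s : α → ℂ}
    (hh : Measurable h) (hs : ∀ x, s x * h x = ‖h x‖) :
    ∫ x, ((F x).toReal * s x) * h x ∂μ = ((∫⁻ x, F x * ‖h x‖ₑ ∂μ).toReal : ℂ) := by
  rw [← integral_toReal (f := fun x => F x * ‖h x‖ₑ) (hF.mul hh.enorm).aemeasurable,
    ← integral_complex_ofReal]
  · refine integral_congr_ae (Eventually.of_forall fun x => ?_)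
    simp [mul_assoc, hs]
  · filter_upwards [hF_top] with x hx
    exact ENNReal.mul_lt_top hx enorm_lt_top

/-- The norm of an element of a mixed Lebesgue space is attained against the unit ball of the
dual one. -/
theorem exists_mixedPairing_eq_norm (hp : ∀ i, 1 < p i) (hq : ∀ i, 1 < q i)
    (hpq : ∀ i, (p i).HolderConjugate (q i)) (h : mixedLp q hq) :
    ∃ f : mixedLp p hp, ‖f‖ ≤ 1 ∧ mixedPairing hp hq hpq h f = ‖h‖ := by
  obtain ⟨F, hF, hF1, hF2⟩ :=
    exists_lintegral_mul_eq_mixedNorm p q hpq h.1.measurable.enorm h.2.ne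
  obtain ⟨s, hs, hs1, hs2⟩ := exists_unimodular_mul_eq_norm h.1.measurable
  have hF_top := ae_lt_top_of_mixedNorm p hp hF (hF1.trans_lt ENNReal.one_lt_top).ne
  have hle : mixedLpNorm p (fun x => (F x).toReal * s x) ≤ 1 := by
    refine (mixedNorm_mono p hp ?_).trans hF1
    filter_upwards [hF_top] with x hx
    rw [enorm_mul]
    refine (mul_le_of_le_one_right' ?_).trans (le_of_eq ?_)
    · exact hs1 x
    · rw [← ofReal_norm]
      simp [ENNReal.ofReal_toReal hx.ne]
  have hf : MemMixedLp p (fun x => (F x).toReal * s x) :=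
    ⟨((Complex.measurable_ofReal.comp hF.ennreal_toReal).mul hs).aestronglyMeasurable,
      hle.trans_lt ENNReal.one_lt_top⟩
  refine ⟨toMixedLp p hp (fun x => (F x).toReal * s x), ?_, ?_⟩
  · rw [← toReal_enorm, enorm_toMixedLp hf]
    exact ENNReal.toReal_mono ENNReal.one_ne_top hle
  · rw [mixedPairing_apply, mixedLp_norm_def, mixedLpNorm, ← hF2,
      ← integral_toReal_mul_unimodular hF hF_top h.1.measurable hs2]
    refine integral_congr_ae ?_
    filter_upwards [coe_toMixedLp (hp := hp) hf] with x hx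
    rw [hx]

end

/-! ### Bounded functionals on mixed Lebesgue spaces are integrals. -/

/-- The Radon–Nikodym theorem for complex measures. -/
theorem exists_density_of_complexMeasure {α : Type*} [MeasurableSpace α] (c : ComplexMeasure α)
    (μ : Measure α) [SigmaFinite μ] (hc : ∀ A, MeasurableSet A → μ A = 0 → c A = 0) :
    ∃ h : α → ℂ, Measurable h ∧ Integrable h μ ∧
      ∀ A, MeasurableSet A → c A = ∫ x in A, h x ∂μ := by
  have hre : c.re ≪ᵥ μ.toENNRealVectorMeasure := by
    refine VectorMeasure.AbsolutelyContinuous.mk fun A hA h => ?_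
    rw [Measure.toENNRealVectorMeasure_apply_measurable hA] at h
    change (c A).re = 0
    rw [hc A hA h, Complex.zero_re]
  have him : c.im ≪ᵥ μ.toENNRealVectorMeasure := by
    refine VectorMeasure.AbsolutelyContinuous.mk fun A hA h => ?_
    rw [Measure.toENNRealVectorMeasure_apply_measurable hA] at h
    change (c A).im = 0
    rw [hc A hA h, Complex.zero_im]
  have hi := c.integrable_rnDeriv μ
  refine ⟨c.rnDeriv μ, ?_, hi, fun A hA => ?_⟩
  · refine Complex.measurableEquivRealProd.symm.measurable.comp
      (Measurable.prodMk (c.re.measurable_rnDeriv μ) (c.im.measurable_rnDeriv μ))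
  · apply Complex.ext
    · have h := congrArg (fun v => v A) (c.re.withDensityᵥ_rnDeriv_eq μ hre)
      rw [withDensityᵥ_apply (SignedMeasure.integrable_rnDeriv _ _) hA] at h
      rw [← RCLike.re_eq_complex_re, ← integral_re hi.integrableOn]
      exact h.symm
    · have h := congrArg (fun v => v A) (c.im.withDensityᵥ_rnDeriv_eq μ him)
      rw [withDensityᵥ_apply (SignedMeasure.integrable_rnDeriv _ _) hA] at h
      rw [← RCLike.im_eq_complex_im, ← integral_im hi.integrableOn]
      exact h.symm

variable {n : ℕ} {p q : Fin n → ℝ}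

theorem memMixedLp_mul_decay (hp : ∀ i, 1 < p i) {φ : (Fin n → ℝ) → ℂ} (hφ : Measurable φ) {C : ℝ}
    (hC : ∀ x, ‖φ x‖ ≤ C) : MemMixedLp p (fun x => φ x * decay x) := by
  refine ((memMixedLp_decay hp).smul hp (C : ℂ)).mono hp
    (hφ.mul (Complex.measurable_ofReal.comp measurable_decay)).aestronglyMeasurable
    (Eventually.of_forall fun x => ?_)
  rw [Pi.smul_apply, smul_eq_mul, enorm_mul, enorm_mul]
  gcongr
  rw [← ofReal_norm, ← ofReal_norm, Complex.norm_real]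
  exact ENNReal.ofReal_le_ofReal ((hC x).trans (Real.le_norm_self C))

theorem memMixedLp_indicator_decay (hp : ∀ i, 1 < p i) {A : Set (Fin n → ℝ)}
    (hA : MeasurableSet A) : MemMixedLp p (A.indicator fun x => (decay x : ℂ)) :=
  (memMixedLp_decay hp).mono hp ((Complex.measurable_ofReal.comp measurable_decay).indicator
    hA).aestronglyMeasurable (Eventually.of_forall fun x => by
      by_cases h : x ∈ A <;> simp [h])

/-- Indicators of finite partial unions, times the weight, converge pointwise and are dominated by
the weight, so they converge in the mixed norm. This is the countable additivity of `dualMeasure`.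
The weight is needed because indicators of sets of infinite measure need not lie in the space. -/
theorem hasSum_dual_indicator_decay {hp : ∀ i, 1 < p i} (L : StrongDual ℂ (mixedLp p hp))
    {A : ℕ → Set (Fin n → ℝ)} (hA : ∀ i, MeasurableSet (A i))
    (hd : Pairwise (Function.onFun Disjoint A)) :
    HasSum (fun i => L (toMixedLp p hp ((A i).indicator fun x => (decay x : ℂ))))
      (L (toMixedLp p hp ((⋃ i, A i).indicator fun x => (decay x : ℂ)))) := by
  have hU (s : Finset ℕ) : (∑ i ∈ s, (A i).indicator fun x => (decay x : ℂ)) =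
      (⋃ i ∈ s, A i).indicator fun x => (decay x : ℂ) := by
    funext x
    rw [Finset.sum_apply, Finset.indicator_biUnion_apply _ _ (fun i _ j _ hij => hd hij)]
  have h1 := fun s : Finset ℕ => toMixedLp_sum (hp := hp) s
    (fun i => memMixedLp_indicator_decay hp (hA i))
  have h2 : Tendsto (fun s : Finset ℕ => toMixedLp p hp
      (∑ i ∈ s, (A i).indicator fun x => (decay x : ℂ))) atTop
      (𝓝 (toMixedLp p hp ((⋃ i, A i).indicator fun x => (decay x : ℂ)))) := by
    refine tendsto_toMixedLp (memMixedLp_decay hp) (fun s => (h1 s).1.1)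
      (memMixedLp_indicator_decay hp (MeasurableSet.iUnion hA)).1 (fun s => ?_) ?_
    · refine Eventually.of_forall fun x => ?_
      rw [hU]
      by_cases h : x ∈ ⋃ i ∈ s, A i
      · rw [Set.indicator_of_mem h]
      · rw [Set.indicator_of_notMem h]
        simp
    · refine Eventually.of_forall fun x => ?_
      simp_rw [hU]
      exact (tendsto_indicator_biUnion_finset A _ x).mono_right (pure_le_nhds _)
  refine ((L.continuous.tendsto _).comp h2).congr fun s => ?_
  rw [Function.comp_apply, (h1 s).2, map_sum]

open Classical in
/-- The complex measure `A ↦ L (χ_A w)` given by a functional `L` on a mixed Lebesgue space, where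
`w` is the decaying weight. -/
def dualMeasure {hp : ∀ i, 1 < p i} (L : StrongDual ℂ (mixedLp p hp)) :
    ComplexMeasure (Fin n → ℝ) where
  measureOf' A := if MeasurableSet A then
    L (toMixedLp p hp (A.indicator fun x => (decay x : ℂ))) else 0
  empty' := by
    have h : (∅ : Set (Fin n → ℝ)).indicator (fun x => (decay x : ℂ)) = 0 :=
      Set.indicator_empty _
    rw [if_pos MeasurableSet.empty, h, toMixedLp_zero, map_zero]
  not_measurable' A hA := if_neg hA
  m_iUnion' A hA hd := by
    rw [if_pos (MeasurableSet.iUnion hA)]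
    simp_rw [if_pos (hA _)]
    exact hasSum_dual_indicator_decay L hA hd

theorem dualMeasure_apply {hp : ∀ i, 1 < p i} (L : StrongDual ℂ (mixedLp p hp))
    {A : Set (Fin n → ℝ)} (hA : MeasurableSet A) :
    dualMeasure L A = L (toMixedLp p hp (A.indicator fun x => (decay x : ℂ))) :=
  if_pos hA

/-- `h` is the density of `dualMeasure L`. The formula holds for simple `φ` by linearity, and for
bounded `φ` by dominated convergence on both sides: the weight dominates on the left, the integrable
`h` on the right. -/
theorem exists_integral_eq_dual_mul_decay {hp : ∀ i, 1 < p i} (L : StrongDual ℂ (mixedLp p hp)) :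
    ∃ h : (Fin n → ℝ) → ℂ, Measurable h ∧ Integrable h ∧
      ∀ φ : (Fin n → ℝ) → ℂ, Measurable φ → (∃ C : ℝ, ∀ x, ‖φ x‖ ≤ C) →
        L (toMixedLp p hp fun x => φ x * decay x) = ∫ x, φ x * h x := by
  obtain ⟨h, hm, hi, hA⟩ := exists_density_of_complexMeasure (dualMeasure L) volume
    fun A hA h0 => by
      rw [dualMeasure_apply L hA, toMixedLp_congr (MemMixedLp.zero hp) (indicator_meas_zero h0),
        toMixedLp_zero, map_zero]
  have hs (φ : SimpleFunc (Fin n → ℝ) ℂ) : MemMixedLp p (fun x => φ x * decay x) := by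
    obtain ⟨C, hC⟩ := φ.exists_forall_norm_le
    exact memMixedLp_mul_decay hp φ.measurable hC
  have hsi (φ : SimpleFunc (Fin n → ℝ) ℂ) : Integrable (fun x => φ x * h x) := by
    obtain ⟨C, hC⟩ := φ.exists_forall_norm_le
    exact hi.bdd_mul φ.measurable.aestronglyMeasurable (Eventually.of_forall hC)
  have hsimple (φ : SimpleFunc (Fin n → ℝ) ℂ) :
      L (toMixedLp p hp fun x => φ x * decay x) = ∫ x, φ x * h x := by
    induction φ using SimpleFunc.induction with
    | const c hs' =>
      rename_i A
      have h1 : (fun x => (SimpleFunc.piecewise A hs' (SimpleFunc.const _ c)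
          (SimpleFunc.const _ 0)) x * (decay x : ℂ)) =
          c • A.indicator fun x => (decay x : ℂ) := by
        funext x
        by_cases hx : x ∈ A <;> simp [hx]
      have h2 : (fun x => (SimpleFunc.piecewise A hs' (SimpleFunc.const _ c)
          (SimpleFunc.const _ 0)) x * h x) = fun x => c • A.indicator h x := by
        funext x
        by_cases hx : x ∈ A <;> simp [hx]
      rw [h1, h2, toMixedLp_smul _ (memMixedLp_indicator_decay hp hs'), map_smul, integral_smul,
        integral_indicator hs', ← hA A hs', dualMeasure_apply L hs']
    | add _ hf hg =>
      rename_i f g _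
      have h1 : (fun x => (f + g) x * (decay x : ℂ)) =
          (fun x => f x * (decay x : ℂ)) + fun x => g x * (decay x : ℂ) := by
        funext x
        simp [add_mul]
      rw [h1, toMixedLp_add (hs f) (hs g), map_add, hf, hg, ← integral_add (hsi f) (hsi g)]
      simp [add_mul]
  refine ⟨h, hm, hi, fun φ hφ ⟨C, hC⟩ => ?_⟩
  have hC0 : 0 ≤ C := (norm_nonneg _).trans (hC 0)
  have hφs := hφ.stronglyMeasurable
  have hmw : Measurable fun x : Fin n → ℝ => (decay x : ℂ) :=
    Complex.measurable_ofReal.comp measurable_decay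
  have hb (j : ℕ) (x) : ‖hφs.approxBounded C j x‖ ≤ C := hφs.norm_approxBounded_le hC0 j x
  have hlim (x) : Tendsto (fun j => hφs.approxBounded C j x) atTop (𝓝 (φ x)) :=
    StronglyMeasurable.tendsto_approxBounded_of_norm_le hφs (hC x)
  have t1 : Tendsto (fun j => toMixedLp p hp fun x => hφs.approxBounded C j x * decay x) atTop
      (𝓝 (toMixedLp p hp fun x => φ x * decay x)) := by
    refine tendsto_toMixedLp ((memMixedLp_decay hp).smul hp (C : ℂ)) (fun j => (hs _).1)
      (hφ.mul hmw).aestronglyMeasurable (fun j => Eventually.of_forall fun x => ?_)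
      (Eventually.of_forall fun x => (hlim x).mul_const _)
    rw [Pi.smul_apply, smul_eq_mul, enorm_mul, enorm_mul]
    gcongr
    rw [← ofReal_norm, ← ofReal_norm, Complex.norm_real]
    exact ENNReal.ofReal_le_ofReal ((hb j x).trans (Real.le_norm_self C))
  have t2 : Tendsto (fun j => ∫ x, hφs.approxBounded C j x * h x) atTop
      (𝓝 (∫ x, φ x * h x)) := by
    refine tendsto_integral_of_dominated_convergence (fun x => C * ‖h x‖) (fun j => (hsi _).1)
      (hi.norm.const_mul C) (fun j => Eventually.of_forall fun x => ?_)
      (Eventually.of_forall fun x => (hlim x).mul_const _)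
    rw [norm_mul]
    gcongr
    exact hb j x
  refine tendsto_nhds_unique ((L.continuous.tendsto _).comp t1) (t2.congr fun j => ?_)
  exact (hsimple _).symm

/-- If a bounded functional on a mixed Lebesgue space is integration against `h` on functions
dominated by the decaying weight, then `h` lies in the dual mixed Lebesgue space. -/
theorem mixedLpNorm_le_of_dual {hp : ∀ i, 1 < p i} (hpq : ∀ i, (p i).HolderConjugate (q i))
    (L : StrongDual ℂ (mixedLp p hp)) {h : (Fin n → ℝ) → ℂ} (hm : Measurable h)
    (hL : ∀ f : (Fin n → ℝ) → ℂ, Measurable f → (∃ C : ℝ, ∀ x, ‖f x‖ ≤ C * decay x) →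
      Integrable (fun x => f x * h x) ∧ L (toMixedLp p hp f) = ∫ x, f x * h x) :
    mixedLpNorm q h ≤ ‖L‖ₑ := by
  have hq (i) : 1 < q i := (hpq i).symm.lt
  set w : (Fin n → ℝ) → ℝ≥0∞ := fun x => ENNReal.ofReal (decay x) with hw
  have hwm : Measurable w := measurable_decay.ennreal_ofReal
  have hw0 (x) : w x ≠ 0 := (ENNReal.ofReal_pos.2 (decay_pos x)).ne'
  -- The weight is strictly positive, so the truncations at `j * w` exhaust every value, including
  -- `∞`.
  have hsup (a : ℝ≥0∞) (x) : ⨆ j : ℕ, min a (j * w x) = a := by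
    have h1 : ⨆ j : ℕ, (j : ℝ≥0∞) * w x = ∞ := by
      rw [← ENNReal.iSup_mul, ENNReal.iSup_natCast, ENNReal.top_mul (hw0 x)]
    rw [← inf_iSup_eq, h1]
    simp
  have hmono (F : (Fin n → ℝ) → ℝ≥0∞) : Monotone fun (j : ℕ) x => min (F x) (j * w x) := by
    intro i j hij x
    simp only
    gcongr
  have hmeas {F : (Fin n → ℝ) → ℝ≥0∞} (hF : Measurable F) (j : ℕ) :
      Measurable fun x => min (F x) (j * w x) := hF.min (hwm.const_mul _)
  obtain ⟨s, hs, hs1, hs2⟩ := exists_unimodular_mul_eq_norm hm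
  have h1 : mixedLpNorm q h = ⨆ m : ℕ, mixedNorm q fun x => min ‖h x‖ₑ (m * w x) := by
    rw [← mixedNorm_iSup q hq (hmeas hm.enorm) (hmono _)]
    simp_rw [hsup]
    rfl
  rw [h1]
  refine iSup_le fun m => ?_
  -- A first truncation, of `‖h‖`, gives a finite norm, as needed for an extremal `F` to exist.
  have hfin : mixedNorm q (fun x => min ‖h x‖ₑ (m * w x)) ≠ ∞ := by
    refine ((mixedNorm_mono q hq (Eventually.of_forall fun x => min_le_right _ _)).trans_lt ?_).ne
    rw [mixedNorm_const_mul q hq _ (ENNReal.natCast_ne_top m)]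
    exact ENNReal.mul_lt_top (ENNReal.natCast_lt_top m) (mixedNorm_decay q hq)
  obtain ⟨F, hF, hF1, hF2⟩ := exists_lintegral_mul_eq_mixedNorm p q hpq (hmeas hm.enorm m) hfin
  rw [← hF2]
  -- A second truncation, of `F`, makes it dominated by a multiple of the weight, so that `hL`
  -- applies to it.
  have h2 : ∫⁻ x, F x * min ‖h x‖ₑ (m * w x) ≤
      ⨆ j : ℕ, ∫⁻ x, min (F x) (j * w x) * ‖h x‖ₑ := by
    rw [← lintegral_iSup (f := fun (j : ℕ) x => min (F x) (j * w x) * ‖h x‖ₑ)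
      (fun j => (hmeas hF j).mul hm.enorm)
      (fun i j hij x => mul_le_mul_left (hmono F hij x) _)]
    refine lintegral_mono fun x => ?_
    simp only
    rw [← ENNReal.iSup_mul, hsup]
    gcongr
    exact min_le_left _ _
  refine h2.trans (iSup_le fun j => ?_)
  set G : (Fin n → ℝ) → ℝ≥0∞ := fun x => min (F x) (j * w x) with hG
  have hGm : Measurable G := hmeas hF j
  have hGt (x) : G x < ∞ :=
    (min_le_right _ _).trans_lt (ENNReal.mul_lt_top (ENNReal.natCast_lt_top j) ENNReal.ofReal_lt_top)
  have hfe (x) : ‖((G x).toReal : ℂ) * s x‖ₑ ≤ G x := by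
    rw [enorm_mul]
    refine (mul_le_of_le_one_right' (hs1 x)).trans (le_of_eq ?_)
    rw [← ofReal_norm]
    simp [ENNReal.ofReal_toReal (hGt x).ne]
  have hfm : Measurable fun x => ((G x).toReal : ℂ) * s x :=
    (Complex.measurable_ofReal.comp hGm.ennreal_toReal).mul hs
  obtain ⟨hint, hLf⟩ := hL (fun x => (G x).toReal * s x) hfm ⟨j, fun x => by
    have h3 : ‖((G x).toReal : ℂ) * s x‖ₑ ≤ ENNReal.ofReal (j * decay x) := by
      rw [ENNReal.ofReal_mul (Nat.cast_nonneg j), ENNReal.ofReal_natCast]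
      exact (hfe x).trans (min_le_right _ _)
    rw [← ofReal_norm] at h3
    exact (ENNReal.ofReal_le_ofReal_iff
      (mul_nonneg (Nat.cast_nonneg j) (decay_pos x).le)).1 h3⟩
  rw [integral_toReal_mul_unimodular hGm (Eventually.of_forall hGt) hm hs2] at hLf
  have hGh : ∫⁻ x, G x * ‖h x‖ₑ ≠ ∞ := by
    refine (lt_of_eq_of_lt (lintegral_congr fun x => ?_) hint.2).ne
    simp only
    have h4 : ‖((G x).toReal : ℂ)‖ₑ = G x := by
      rw [← ofReal_norm, Complex.norm_real, Real.norm_of_nonneg ENNReal.toReal_nonneg,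
        ENNReal.ofReal_toReal (hGt x).ne]
    rw [mul_assoc, hs2, enorm_mul, h4, ← ofReal_norm (‖h x‖ : ℂ), Complex.norm_real, norm_norm,
      ofReal_norm]
  have hfle : mixedLpNorm p (fun x => (G x).toReal * s x) ≤ 1 :=
    (mixedNorm_mono p hp (Eventually.of_forall fun x => (hfe x).trans (min_le_left _ _))).trans hF1
  calc ∫⁻ x, G x * ‖h x‖ₑ
      = ‖L (toMixedLp p hp fun x => (G x).toReal * s x)‖ₑ := by
        rw [hLf, ← ofReal_norm]
        simp [ENNReal.ofReal_toReal hGh]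
    _ ≤ ‖L‖ₑ * ‖toMixedLp p hp fun x => (G x).toReal * s x‖ₑ := L.le_opENorm _
    _ ≤ ‖L‖ₑ * 1 := by
        gcongr
        rw [enorm_toMixedLp ⟨hfm.aestronglyMeasurable, hfle.trans_lt ENNReal.one_lt_top⟩]
        exact hfle
    _ = ‖L‖ₑ := mul_one _

/-- Every bounded functional on a mixed Lebesgue space is integration against an element of the
mixed Lebesgue space with conjugate exponents. -/
theorem mixedPairing_surjective (hp : ∀ i, 1 < p i) (hq : ∀ i, 1 < q i)
    (hpq : ∀ i, (p i).HolderConjugate (q i)) :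
    Function.Surjective (mixedPairing hp hq hpq) := by
  intro L
  obtain ⟨h₀, hm₀, hi₀, hL₀⟩ := exists_integral_eq_dual_mul_decay L
  have hwm : Measurable fun x : Fin n → ℝ => (decay x : ℂ) :=
    Complex.measurable_ofReal.comp measurable_decay
  have hw0 (x : Fin n → ℝ) : (decay x : ℂ) ≠ 0 := by
    exact_mod_cast (decay_pos x).ne'
  -- The density of `dualMeasure L` represents `L` after multiplication by the weight; dividing by
  -- the weight undoes this.
  set h : (Fin n → ℝ) → ℂ := fun x => h₀ x / decay x with hh
  have hm : Measurable h := hm₀.div hwm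
  have hL : ∀ f : (Fin n → ℝ) → ℂ, Measurable f → (∃ C : ℝ, ∀ x, ‖f x‖ ≤ C * decay x) →
      Integrable (fun x => f x * h x) ∧ L (toMixedLp p hp f) = ∫ x, f x * h x := by
    rintro f hf ⟨C, hC⟩
    have hb (x) : ‖f x / decay x‖ ≤ C := by
      rw [norm_div, Complex.norm_real, Real.norm_of_nonneg (decay_pos x).le,
        div_le_iff₀ (decay_pos x)]
      exact hC x
    have h1 : (fun x => f x * h x) = fun x => f x / decay x * h₀ x := by
      funext x
      rw [hh]
      ring
    have h2 : f = fun x => f x / decay x * decay x := by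
      funext x
      rw [div_mul_cancel₀ _ (hw0 x)]
    rw [h1]
    refine ⟨hi₀.bdd_mul (hf.div hwm).aestronglyMeasurable (Eventually.of_forall hb), ?_⟩
    rw [← hL₀ (fun x => f x / decay x) (hf.div hwm) ⟨C, hb⟩, ← h2]
  have hle := mixedLpNorm_le_of_dual hpq L hm hL
  have hmem : MemMixedLp q h := ⟨hm.aestronglyMeasurable, hle.trans_lt enorm_lt_top⟩
  refine ⟨toMixedLp q hq h, ?_⟩
  ext f
  have hfm : Measurable f.1 := f.1.measurable
  -- On these sets `f` is dominated by a multiple of the weight, so `hL` covers the cut-off of `f`.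
  -- They increase to the whole space, and both sides pass to the limit by dominated convergence.
  set A : ℕ → Set (Fin n → ℝ) := fun j => {x | ‖f.1 x‖ ≤ j * decay x} with hA
  have hAm (j) : MeasurableSet (A j) :=
    measurableSet_le hfm.norm (measurable_decay.const_mul _)
  have hlim (x) : Tendsto (fun j => (A j).indicator f.1 x) atTop (𝓝 (f.1 x)) := by
    obtain ⟨N, hN⟩ := exists_nat_ge (‖f.1 x‖ / decay x)
    rw [div_le_iff₀ (decay_pos x)] at hN
    refine tendsto_const_nhds.congr' ?_
    filter_upwards [eventually_ge_atTop N] with j hj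
    have hx : x ∈ A j := hN.trans (by have := decay_pos x; gcongr)
    rw [Set.indicator_of_mem hx]
  have hle1 (j x) : ‖(A j).indicator f.1 x‖ ≤ ‖f.1 x‖ := norm_indicator_le_norm_self _ _
  have t1 : Tendsto (fun j => toMixedLp p hp ((A j).indicator f.1)) atTop (𝓝 f) := by
    conv_rhs => rw [← toMixedLp_coe f]
    refine tendsto_toMixedLp (memMixedLp_coe f)
      (fun j => (hfm.indicator (hAm j)).aestronglyMeasurable) hfm.aestronglyMeasurable
      (fun j => Eventually.of_forall fun x => enorm_le_iff_norm_le.2 (hle1 j x))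
      (Eventually.of_forall hlim)
  have hfh := (memMixedLp_coe f).integrable_mul hpq hmem
  have t2 : Tendsto (fun j => ∫ x, (A j).indicator f.1 x * h x) atTop
      (𝓝 (∫ x, f.1 x * h x)) := by
    refine tendsto_integral_of_dominated_convergence (fun x => ‖f.1 x * h x‖)
      (fun j => ((hfm.indicator (hAm j)).mul hm).aestronglyMeasurable) hfh.norm
      (fun j => Eventually.of_forall fun x => ?_)
      (Eventually.of_forall fun x => (hlim x).mul_const _)
    rw [norm_mul, norm_mul]
    exact mul_le_mul_of_nonneg_right (hle1 j x) (norm_nonneg _)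
  have h3 : ∫ x, f.1 x * (toMixedLp q hq h).1 x = ∫ x, f.1 x * h x := by
    refine integral_congr_ae ?_
    filter_upwards [coe_toMixedLp (hp := hq) hmem] with x hx
    rw [hx]
  rw [mixedPairing_apply, h3]
  refine tendsto_nhds_unique t2 (((L.continuous.tendsto _).comp t1).congr fun j => ?_)
  refine (hL _ (hfm.indicator (hAm j)) ⟨j, fun x => ?_⟩).2
  by_cases hx : x ∈ A j
  · rw [Set.indicator_of_mem hx]
    exact hx
  · rw [Set.indicator_of_notMem hx, norm_zero]
    exact mul_nonneg (Nat.cast_nonneg j) (decay_pos x).le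

/-! ### Duality of vector-valued sequence spaces. -/

/-- If `E` represents the dual of `F` through `B`, with norms of elements of `E` attained on the
unit ball of `F`, then `ℓ^P(E)` represents the dual of `ℓ^Q(F)` for conjugate `P`, `Q`. -/
theorem exists_dualPairing_eq {ι E F : Type*} [NormedAddCommGroup E] [NormedSpace ℂ E]
    [NormedAddCommGroup F] [NormedSpace ℂ F] (P Q : ℝ≥0∞) [Fact (1 ≤ P)] [Fact (1 ≤ Q)]
    [P.HolderConjugate Q] (hP : P ≠ ∞) (hQ : Q ≠ ∞) (B : E →L[ℂ] F →L[ℂ] ℂ)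
    (hB : ∀ _ : ι, ‖B‖ ≤ (1 : NNReal)) (hsurj : Function.Surjective B)
    (hatt : ∀ e, ∃ f, ‖f‖ ≤ 1 ∧ B e f = ‖e‖) (L : StrongDual ℂ (lp (fun _ : ι => F) Q)) :
    ∃ h : lp (fun _ : ι => E) P, ‖h‖ ≤ ‖L‖ ∧
      L = lp.dualPairing P Q (fun _ : ι => B) hB h := by
  classical
  have hpq : P.toReal.HolderConjugate Q.toReal := ENNReal.HolderConjugate.toReal_of_ne_top hP hQ
  choose h hh using fun k : ι => hsurj (L.comp (lp.singleContinuousLinearMap ℂ (fun _ => F) Q k))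
  choose f hf1 hf2 using fun k => hatt (h k)
  have hLh (k : ι) (x : F) : L (lp.single Q k x) = B (h k) x := by
    rw [hh]
    rfl
  have hsum (s : Finset ι) : ∑ k ∈ s, ‖h k‖ ^ P.toReal ≤ ‖L‖ ^ P.toReal := by
    set S := ∑ k ∈ s, ‖h k‖ ^ P.toReal with hS
    have hS0 : 0 ≤ S := Finset.sum_nonneg fun k _ => by positivity
    rcases hS0.eq_or_lt with h0 | h0
    · rw [← h0]
      positivity
    -- The equality case of Hölder's inequality: `L` takes the value `S` on this finitely supported
    -- family, whose norm is at most `S^(1/Q)`. Dividing by `S^(1/Q)`, possible as `S > 0`, gives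
    -- `S^(1/P) ≤ ‖L‖`.
    set y : ι → F := fun k => ((‖h k‖ ^ (P.toReal - 1) : ℝ) : ℂ) • f k with hy
    have hx : L (∑ k ∈ s, lp.single Q k (y k)) = (S : ℂ) := by
      rw [map_sum, hS]
      push_cast
      refine Finset.sum_congr rfl fun k _ => ?_
      rw [hLh, hy, map_smul, hf2, smul_eq_mul, ← Complex.ofReal_mul]
      norm_cast
      have := Real.rpow_add_one' (norm_nonneg (h k)) (y := P.toReal - 1)
        (by simpa using hpq.pos.ne')
      rw [← this, sub_add_cancel]
    have hxn : ‖∑ k ∈ s, lp.single Q k (y k)‖ ^ Q.toReal ≤ S := by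
      rw [lp.norm_sum_single hpq.symm.pos, hS]
      refine Finset.sum_le_sum fun k _ => ?_
      have h1 : ‖y k‖ ≤ ‖h k‖ ^ (P.toReal - 1) := by
        rw [hy, norm_smul, Complex.norm_real, Real.norm_of_nonneg (by positivity)]
        exact mul_le_of_le_one_right (by positivity) (hf1 k)
      refine (Real.rpow_le_rpow (norm_nonneg _) h1 hpq.symm.nonneg).trans (le_of_eq ?_)
      rw [← Real.rpow_mul (norm_nonneg _), hpq.sub_one_mul_conj]
    have h2 : S ≤ ‖L‖ * S ^ (1 / Q.toReal) := by
      have h3 := L.le_opNorm (∑ k ∈ s, lp.single Q k (y k))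
      rw [hx, Complex.norm_real, Real.norm_of_nonneg hS0] at h3
      refine h3.trans (mul_le_mul_of_nonneg_left ?_ (norm_nonneg _))
      rw [← Real.rpow_le_rpow_iff (norm_nonneg _) (by positivity) hpq.symm.pos,
        ← Real.rpow_mul hS0, one_div_mul_cancel hpq.symm.ne_zero, Real.rpow_one]
      exact hxn
    have h4 : S ^ (1 / P.toReal) ≤ ‖L‖ := by
      have h5 : S = S ^ (1 / P.toReal) * S ^ (1 / Q.toReal) := by
        rw [← Real.rpow_add h0, one_div, one_div, hpq.inv_add_inv_eq_one, Real.rpow_one]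
      have h6 : 0 < S ^ (1 / Q.toReal) := by positivity
      exact le_of_mul_le_mul_right (h5.symm.le.trans h2) h6
    calc S = (S ^ (1 / P.toReal)) ^ P.toReal := by
          rw [← Real.rpow_mul hS0, one_div_mul_cancel hpq.ne_zero, Real.rpow_one]
      _ ≤ ‖L‖ ^ P.toReal := Real.rpow_le_rpow (by positivity) h4 hpq.nonneg
  -- The uniform bound on finite sums yields both membership and the norm estimate. The functionals
  -- agree because they agree on single-entry families, whose sums converge in `ℓ^Q` for `Q ≠ ∞`.
  refine ⟨⟨h, memℓp_gen' hsum⟩, lp.norm_le_of_forall_sum_le hpq.pos (norm_nonneg L) hsum, ?_⟩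
  ext z
  rw [lp.dualPairing_apply, ← ((lp.hasSum_single hQ z).mapL L).tsum_eq]
  exact tsum_congr fun k => hLh k _

/-! ### Dyadic cubes, and unit cubes in the Bourgain–Morrey space. -/

theorem prod_rpow_eq_rpow_sum {ι : Type*} {a : ℝ≥0∞} (h0 : a ≠ 0) (ht : a ≠ ∞) (s : Finset ι)
    (u : ι → ℝ) : ∏ i ∈ s, a ^ u i = a ^ ∑ i ∈ s, u i := by
  classical
  induction s using Finset.induction_on with
  | empty => simp
  | insert i s hi ih =>
    rw [Finset.prod_insert hi, Finset.sum_insert hi, ih, ENNReal.rpow_add _ _ h0 ht]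

section Cubes

variable {n : ℕ}

theorem mem_dyadicCube {k : DyadicIndex n} {x : Fin n → ℝ} :
    x ∈ dyadicCube k ↔ ∀ i, (2 : ℝ) ^ (-k.1) * (k.2 i : ℝ) ≤ x i ∧
      x i < (2 : ℝ) ^ (-k.1) * ((k.2 i : ℝ) + 1) := by
  simp [dyadicCube, Set.mem_pi]

theorem mem_dyadicCube_zero_floor (x : Fin n → ℝ) : x ∈ dyadicCube (0, fun i => ⌊x i⌋) := by
  rw [mem_dyadicCube]
  intro i
  simp [Int.floor_le, Int.lt_floor_add_one]

/-- In units of the finer side length all endpoints are integers, the coarse side being `2 ^ N`. A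
common point gives strict inequalities between integers, which sharpen to the inclusion of the
intervals. -/
theorem dyadicCube_subset_of_nonempty_inter {k k' : DyadicIndex n} (hkk : k'.1 ≤ k.1)
    (h : (dyadicCube k ∩ dyadicCube k').Nonempty) : dyadicCube k ⊆ dyadicCube k' := by
  obtain ⟨x, hx, hx'⟩ := h
  intro y hy
  rw [mem_dyadicCube] at hx hx' hy ⊢
  intro i
  obtain ⟨N, hN⟩ := Int.eq_ofNat_of_zero_le (sub_nonneg.2 hkk)
  set a : ℝ := (2 : ℝ) ^ (-k.1) with ha
  have ha0 : 0 < a := by positivity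
  have hA : (2 : ℝ) ^ (-k'.1) = a * ((2 ^ N : ℤ) : ℝ) := by
    rw [ha]
    push_cast
    rw [← zpow_natCast, ← zpow_add₀ two_ne_zero]
    congr 1
    omega
  obtain ⟨h1, h2⟩ := hx i
  obtain ⟨h3, h4⟩ := hx' i
  obtain ⟨h5, h6⟩ := hy i
  rw [hA, mul_assoc] at h3 h4 ⊢
  rw [mul_assoc]
  have h7 : (2 ^ N : ℤ) * k'.2 i ≤ k.2 i := by
    have := lt_of_mul_lt_mul_left (h3.trans_lt h2) ha0.le
    exact Int.lt_add_one_iff.1 (by exact_mod_cast this)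
  have h8 : k.2 i + 1 ≤ (2 ^ N : ℤ) * (k'.2 i + 1) := by
    have := lt_of_mul_lt_mul_left (h1.trans_lt h4) ha0.le
    exact Int.add_one_le_iff.2 (by exact_mod_cast this)
  constructor
  · refine le_trans ?_ h5
    gcongr
    exact_mod_cast h7
  · refine h6.trans_le ?_
    gcongr
    exact_mod_cast h8

theorem disjoint_dyadicCube_of_ne (j : ℤ) :
    Pairwise (Function.onFun Disjoint fun l : Fin n → ℤ => dyadicCube (j, l)) := by
  intro l l' hl
  refine Set.disjoint_left.2 fun x hx hx' => hl ?_
  funext i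
  rw [mem_dyadicCube] at hx hx'
  have h (m : Fin n → ℤ) (hm : (2 : ℝ) ^ (-j) * (m i : ℝ) ≤ x i ∧
      x i < (2 : ℝ) ^ (-j) * ((m i : ℝ) + 1)) : ⌊x i / (2 : ℝ) ^ (-j)⌋ = m i := by
    have h0 : (0 : ℝ) < (2 : ℝ) ^ (-j) := by positivity
    rw [Int.floor_eq_iff, le_div_iff₀ h0, div_lt_iff₀ h0, mul_comm, mul_comm _ ((2 : ℝ) ^ (-j))]
    exact hm
  exact (h l (hx i)).symm.trans (h l' (hx' i))

theorem mixedLpNorm_indicator_dyadicCube (p : Fin n → ℝ) (hp : ∀ i, 1 < p i) (k : DyadicIndex n) :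
    mixedLpNorm p ((dyadicCube k).indicator 1) =
      ENNReal.ofReal ((2 : ℝ) ^ (-k.1)) ^ ∑ i, 1 / p i := by
  have h0 : ENNReal.ofReal ((2 : ℝ) ^ (-k.1)) ≠ 0 := (ENNReal.ofReal_pos.2 (by positivity)).ne'
  set I : Fin n → Set ℝ := fun i =>
    Set.Ico ((2 : ℝ) ^ (-k.1) * (k.2 i : ℝ)) ((2 : ℝ) ^ (-k.1) * ((k.2 i : ℝ) + 1)) with hI
  have hint (i) : ∫⁻ x, (I i).indicator (1 : ℝ → ℝ≥0∞) x ^ p i =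
      ENNReal.ofReal ((2 : ℝ) ^ (-k.1)) := by
    have h1 (x : ℝ) : (I i).indicator (1 : ℝ → ℝ≥0∞) x ^ p i = (I i).indicator 1 x := by
      by_cases hx : x ∈ I i
      · simp [hx]
      · simp [hx, zero_lt_one.trans (hp i)]
    simp_rw [h1]
    rw [lintegral_indicator_one measurableSet_Ico, Real.volume_Ico]
    congr 1
    ring
  have h1 : mixedLpNorm p ((dyadicCube k).indicator 1) =
      mixedNorm p (fun x => ∏ i, (I i).indicator (1 : ℝ → ℝ≥0∞) (x i)) := by
    rw [mixedLpNorm]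
    congr 1
    funext x
    by_cases hx : x ∈ dyadicCube k
    · have hx' (i) : x i ∈ I i := mem_dyadicCube.1 hx i
      simp [hx, hx']
    · have : ∃ i, x i ∉ I i := by
        by_contra! hc
        exact hx (mem_dyadicCube.2 hc)
      obtain ⟨i, hi⟩ := this
      rw [Finset.prod_eq_zero (Finset.mem_univ i) (by simp [hi])]
      simp [hx]
  rw [h1, mixedNorm_prod p hp (fun i => (I i).indicator 1)
    (fun i => measurable_one.indicator measurableSet_Ico)
    (fun i => by rw [hint]; exact ENNReal.ofReal_ne_top)]
  refine (Finset.prod_congr rfl fun i _ => by rw [hint]).trans ?_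
  exact prod_rpow_eq_rpow_sum h0 ENNReal.ofReal_ne_top _ _

/-- Cubes of one generation are disjoint. Summing over positions inside a unit cube thus costs a
factor of at most one, and only the sum over generations remains. -/
theorem tsum_volume_dyadicCube_inter_le (j : ℤ) (A : Set (Fin n → ℝ)) (hA : MeasurableSet A) :
    ∑' l : Fin n → ℤ, volume (dyadicCube (j, l) ∩ A) ≤ volume A := by
  refine (tsum_meas_le_meas_iUnion_of_disjoint volume
    (fun l => (measurableSet_dyadicCube _).inter hA) ?_).trans
    (measure_mono (Set.iUnion_subset fun l => Set.inter_subset_right))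
  intro l l' hl
  exact (disjoint_dyadicCube_of_ne j hl).mono Set.inter_subset_left Set.inter_subset_left

/-- The level-dependent factor in the estimate of the Bourgain–Morrey norm of a unit cube. -/
theorem bmTerm_unitCube_le (p : Fin n → ℝ) (t r : ℝ) (hp : ∀ i, 1 < p i)
    (hn : 1 < (n : ℝ) / ∑ i, 1 / p i) (ht : (n : ℝ) / ∑ i, 1 / p i < t) (htr : t < r)
    (m : Fin n → ℤ) (k : DyadicIndex n) :
    volume (dyadicCube k) ^ (r / t - r / n * ∑ i, 1 / p i) *
      mixedLpNorm p ((dyadicCube k).indicator ((dyadicCube (0, m)).indicator 1)) ^ r ≤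
    ENNReal.ofReal (((2 : ℝ) ^ (-(n * (r / t - 1)))) ^ k.1.natAbs +
      ((2 : ℝ) ^ (-(r * ∑ i, 1 / p i - n * (r / t)))) ^ k.1.natAbs) *
      volume (dyadicCube k ∩ dyadicCube (0, m)) := by
  set s := ∑ i, 1 / p i with hs
  have ht0 : 0 < t := by linarith
  have hr0 : 0 < r := by linarith
  have hs0 : 0 < s := by
    by_contra! h
    have := div_nonpos_of_nonneg_of_nonpos (Nat.cast_nonneg n : (0 : ℝ) ≤ n) h
    linarith
  have hn0 : (n : ℝ) ≠ 0 := by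
    intro h
    rw [h, zero_div] at hn
    linarith
  set a := ENNReal.ofReal ((2 : ℝ) ^ (-k.1)) with ha
  have ha0 : a ≠ 0 := (ENNReal.ofReal_pos.2 (by positivity)).ne'
  have hat : a ≠ ∞ := ENNReal.ofReal_ne_top
  have hpow (u : ℝ) : a ^ u = ENNReal.ofReal ((2 : ℝ) ^ (-(k.1 : ℝ) * u)) := by
    rw [ha, ENNReal.ofReal_rpow_of_pos (by positivity), Real.rpow_mul two_pos.le]
    congr 2
    rw [← Real.rpow_intCast]
    push_cast
    rfl
  rcases Set.eq_empty_or_nonempty (dyadicCube k ∩ dyadicCube (0, m)) with h | h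
  · rw [Set.indicator_indicator, h, Set.indicator_empty]
    have h0 : mixedLpNorm p (fun _ : Fin n → ℝ => (0 : ℂ)) = 0 := mixedLpNorm_zero p hp
    rw [h0, ENNReal.zero_rpow_of_pos hr0]
    simp
  rw [Set.indicator_indicator, volume_dyadicCube, ← ENNReal.rpow_natCast, ← ENNReal.rpow_mul]
  -- Let `a` be the side length and `s = ∑ 1/pᵢ`. A cube with `a ≤ 1` lies in the unit cube and its
  -- term is `a^(n r/t) = a^(n (r/t - 1)) |Q|`. A cube with `a ≥ 1` contains the unit cube and its
  -- term is `a^(n r/t - r s)`, the intersection having volume one.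
  rcases le_total 0 k.1 with hk | hk
  · rw [Set.inter_eq_left.2 (dyadicCube_subset_of_nonempty_inter (k' := (0, m)) hk h),
      mixedLpNorm_indicator_dyadicCube p hp, volume_dyadicCube, ← ENNReal.rpow_mul,
      ← ENNReal.rpow_add _ _ ha0 hat, ← ENNReal.rpow_natCast]
    have e : (n : ℝ) * (r / t - r / n * s) + s * r = n * (r / t - 1) + n := by
      field_simp
      ring
    rw [e, ENNReal.rpow_add _ _ ha0 hat, hpow]
    gcongr
    refine le_trans (le_of_eq ?_) (le_add_of_nonneg_right (by positivity))
    rw [← Real.rpow_natCast, ← Real.rpow_mul two_pos.le, Nat.cast_natAbs, abs_of_nonneg hk]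
    congr 1
    ring
  · have h' : (dyadicCube (0, m) ∩ dyadicCube k).Nonempty := by rwa [Set.inter_comm]
    rw [Set.inter_eq_right.2 (dyadicCube_subset_of_nonempty_inter (k := (0, m)) hk h'),
      mixedLpNorm_indicator_dyadicCube p hp, volume_dyadicCube]
    simp only [neg_zero, zpow_zero, ENNReal.ofReal_one, ENNReal.one_rpow, one_pow, mul_one]
    rw [hpow]
    gcongr
    refine le_trans (le_of_eq ?_) (le_add_of_nonneg_left (by positivity))
    rw [← Real.rpow_natCast, ← Real.rpow_mul two_pos.le, Nat.cast_natAbs, abs_of_nonpos hk]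
    congr 1
    push_cast
    field_simp
    ring

/-- Both ranges of generations give geometric series: `t < r` makes the small cubes summable, and `n
/ ∑ 1/pᵢ < t` the large ones. -/
theorem bmNorm_unitCube_lt_top (p : Fin n → ℝ) (t r : ℝ) (hp : ∀ i, 1 < p i)
    (hn : 1 < (n : ℝ) / ∑ i, 1 / p i) (ht : (n : ℝ) / ∑ i, 1 / p i < t) (htr : t < r)
    (m : Fin n → ℤ) : bmNorm p t r ((dyadicCube (0, m)).indicator 1) < ∞ := by
  have ht0 : 0 < t := by linarith
  have hr0 : 0 < r := by linarith
  have hs0 : 0 < ∑ i, 1 / p i := by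
    by_contra! h
    have := div_nonpos_of_nonneg_of_nonpos (Nat.cast_nonneg n : (0 : ℝ) ≤ n) h
    linarith
  have hn0 : 0 < (n : ℝ) := by
    refine lt_of_le_of_ne (Nat.cast_nonneg n) fun h => ?_
    rw [← h, zero_div] at hn
    linarith
  set α := (n : ℝ) * (r / t - 1)
  set β := r * ∑ i, 1 / p i - n * (r / t)
  have hα : 0 < α := mul_pos hn0 (sub_pos.2 ((one_lt_div ht0).2 htr))
  have hβ : 0 < β := by
    have h1 : (n : ℝ) < t * ∑ i, 1 / p i := (div_lt_iff₀ hs0).1 ht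
    have h2 : n * (r / t) < r * ∑ i, 1 / p i := by
      rw [← mul_div_assoc, div_lt_iff₀ ht0]
      nlinarith
    exact sub_pos.2 h2
  have hgeo (γ : ℝ) (hγ : 0 < γ) : Summable fun j : ℤ => ((2 : ℝ) ^ (-γ)) ^ j.natAbs := by
    have h1 : Summable fun j : ℕ => ((2 : ℝ) ^ (-γ)) ^ j :=
      summable_geometric_of_lt_one (by positivity)
        (Real.rpow_lt_one_of_one_lt_of_neg one_lt_two (neg_lt_zero.2 hγ))
    exact Summable.of_nat_of_neg (by simpa using h1) (by simpa using h1)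
  have hC := (hgeo α hα).add (hgeo β hβ)
  refine ENNReal.rpow_lt_top_of_nonneg (one_div_nonneg.2 hr0.le) (ne_of_lt ?_)
  refine lt_of_le_of_lt (ENNReal.tsum_le_tsum fun k =>
    bmTerm_unitCube_le p t r hp hn ht htr m k) ?_
  rw [ENNReal.tsum_prod']
  refine lt_of_le_of_lt (ENNReal.tsum_le_tsum (g := fun j : ℤ =>
    ENNReal.ofReal (((2 : ℝ) ^ (-α)) ^ j.natAbs + ((2 : ℝ) ^ (-β)) ^ j.natAbs)) fun j => ?_) ?_
  · dsimp only
    rw [ENNReal.tsum_mul_left]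
    refine mul_le_of_le_one_right' ((tsum_volume_dyadicCube_inter_le j _
      (measurableSet_dyadicCube _)).trans (le_of_eq ?_))
    rw [volume_dyadicCube]
    simp
  · rw [← ENNReal.ofReal_tsum_of_nonneg (fun j => by positivity) hC]
    exact ENNReal.ofReal_lt_top

end Cubes

/-! ### Cube weights and weighted restrictions. -/

section Weights

variable {n : ℕ} {p : Fin n → ℝ} {t : ℝ}

variable (p t) in
/-- The weight of a cube in the mixed Bourgain–Morrey norm. -/
def cubeWeight (k : DyadicIndex n) : ℝ :=
  (volume (dyadicCube k) ^ (1 / t - 1 / n * ∑ i, 1 / p i)).toReal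

theorem ofReal_cubeWeight (k : DyadicIndex n) :
    ENNReal.ofReal (cubeWeight p t k) =
      volume (dyadicCube k) ^ (1 / t - 1 / n * ∑ i, 1 / p i) := by
  refine ENNReal.ofReal_toReal (ENNReal.rpow_ne_top_of_ne_zero ?_ ?_)
  · rw [volume_dyadicCube]
    exact (ENNReal.pow_pos (ENNReal.ofReal_pos.2 (by positivity)) n).ne'
  · rw [volume_dyadicCube]
    exact ENNReal.pow_ne_top ENNReal.ofReal_ne_top

theorem cubeWeight_pos (k : DyadicIndex n) : 0 < cubeWeight p t k := by
  rw [← ENNReal.ofReal_pos, ofReal_cubeWeight]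
  refine ENNReal.rpow_pos ?_ ?_
  · rw [volume_dyadicCube]
    exact ENNReal.pow_pos (ENNReal.ofReal_pos.2 (by positivity)) n
  · rw [volume_dyadicCube]
    exact ENNReal.pow_ne_top ENNReal.ofReal_ne_top

theorem cubeWeight_ne_zero (k : DyadicIndex n) : (cubeWeight p t k : ℂ) ≠ 0 := by
  exact_mod_cast (cubeWeight_pos k).ne'

theorem enorm_cubeWeight (k : DyadicIndex n) :
    ‖(cubeWeight p t k : ℂ)‖ₑ = volume (dyadicCube k) ^ (1 / t - 1 / n * ∑ i, 1 / p i) := by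
  rw [← ofReal_norm, Complex.norm_real, Real.norm_of_nonneg (cubeWeight_pos k).le,
    ofReal_cubeWeight]

variable (p t) in
/-- The weighted restriction of a function to a dyadic cube. -/
def cubePart (k : DyadicIndex n) (f : (Fin n → ℝ) → ℂ) : (Fin n → ℝ) → ℂ :=
  (cubeWeight p t k : ℂ) • (dyadicCube k).indicator f

theorem cubePart_of_mem {k : DyadicIndex n} {f : (Fin n → ℝ) → ℂ} {x : Fin n → ℝ}
    (hx : x ∈ dyadicCube k) : cubePart p t k f x = cubeWeight p t k * f x := by
  simp [cubePart, hx]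

theorem cubePart_of_notMem {k : DyadicIndex n} {f : (Fin n → ℝ) → ℂ} {x : Fin n → ℝ}
    (hx : x ∉ dyadicCube k) : cubePart p t k f x = 0 := by
  simp [cubePart, hx]

/-- Weighted restriction is symmetric under the pairing. Moving it from `f` to `h` turns the pairing
of families into integration of `f` against a synthesised function. -/
theorem cubePart_mul (k : DyadicIndex n) (f h : (Fin n → ℝ) → ℂ) (x : Fin n → ℝ) :
    cubePart p t k f x * h x = f x * cubePart p t k h x := by
  by_cases hx : x ∈ dyadicCube k
  · rw [cubePart_of_mem hx, cubePart_of_mem hx]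
    ring
  · rw [cubePart_of_notMem hx, cubePart_of_notMem hx, zero_mul, mul_zero]

theorem cubePart_congr (k : DyadicIndex n) {f h : (Fin n → ℝ) → ℂ} (hfh : f =ᵐ[volume] h) :
    cubePart p t k f =ᵐ[volume] cubePart p t k h := by
  filter_upwards [hfh] with x hx
  by_cases hk : x ∈ dyadicCube k
  · rw [cubePart_of_mem hk, cubePart_of_mem hk, hx]
  · rw [cubePart_of_notMem hk, cubePart_of_notMem hk]

theorem aestronglyMeasurable_cubePart (k : DyadicIndex n) {f : (Fin n → ℝ) → ℂ}
    (hf : AEStronglyMeasurable f volume) : AEStronglyMeasurable (cubePart p t k f) volume :=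
  (hf.indicator (measurableSet_dyadicCube k)).const_smul _

theorem MemMixedLp.cubePart {u : Fin n → ℝ} (hu : ∀ i, 1 < u i) (k : DyadicIndex n)
    {f : (Fin n → ℝ) → ℂ} (hf : MemMixedLp u f) : MemMixedLp u (cubePart p t k f) :=
  (hf.mono hu (hf.1.indicator (measurableSet_dyadicCube k)) (Eventually.of_forall fun x => by
    by_cases hx : x ∈ dyadicCube k <;> simp [hx])).smul hu _

theorem mixedLpNorm_cubePart_le {u : Fin n → ℝ} (hu : ∀ i, 1 < u i) (k : DyadicIndex n)
    (f : (Fin n → ℝ) → ℂ) : mixedLpNorm u (cubePart p t k f) ≤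
      volume (dyadicCube k) ^ (1 / t - 1 / n * ∑ i, 1 / p i) * mixedLpNorm u f := by
  rw [MixedBourgainMorrey.cubePart, mixedLpNorm_smul u hu, enorm_cubeWeight]
  gcongr
  exact mixedLpNorm_mono u hu (Eventually.of_forall fun x => by
    by_cases hx : x ∈ dyadicCube k <;> simp [hx])

theorem bmNorm_eq_tsum_cubePart (hp : ∀ i, 1 < p i) {r : ℝ} (hr : 1 < r)
    (f : (Fin n → ℝ) → ℂ) :
    bmNorm p t r f = (∑' k, mixedLpNorm p (cubePart p t k f) ^ r) ^ (1 / r) := by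
  let _ : MeasurableSpace (DyadicIndex n) := ⊤
  rw [bmNorm_eq p t r hr, lintegral_count]
  congr 2
  funext k
  rw [cubePart, mixedLpNorm_smul p hp, enorm_cubeWeight]

end Weights

/-! ### The isometric embedding into a sequence space. -/

section Embedding

variable {n : ℕ} {p : Fin n → ℝ} {t r : ℝ} {hp : ∀ i, 1 < p i} {hr : 1 < r}

theorem tsum_cubePart_ne_top (f : bmSpace p t r hp hr) :
    ∑' k, mixedLpNorm p (cubePart p t k f.1) ^ r ≠ ∞ := by
  have h : bmNorm p t r f.1 < ∞ := f.2
  rw [bmNorm_eq_tsum_cubePart hp hr,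
    ENNReal.rpow_lt_top_iff_of_pos (one_div_pos.2 (zero_lt_one.trans hr))] at h
  exact h.ne

theorem memMixedLp_cubePart (f : bmSpace p t r hp hr) (k : DyadicIndex n) :
    MemMixedLp p (cubePart p t k f.1) :=
  ⟨aestronglyMeasurable_cubePart k f.1.aestronglyMeasurable,
    (ENNReal.rpow_lt_top_iff_of_pos (zero_lt_one.trans hr)).1
      (ENNReal.ne_top_of_tsum_ne_top (tsum_cubePart_ne_top f) k).lt_top⟩

theorem norm_toMixedLp_cubePart (f : bmSpace p t r hp hr) (k : DyadicIndex n) :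
    ‖toMixedLp p hp (cubePart p t k f.1)‖ ^ r =
      (mixedLpNorm p (cubePart p t k f.1) ^ r).toReal := by
  rw [← toReal_enorm, enorm_toMixedLp (memMixedLp_cubePart f k), ENNReal.toReal_rpow]

/-- The isometric embedding of the mixed Bourgain–Morrey space into the `ℓ^r` space of mixed
Lebesgue functions indexed by the dyadic cubes. -/
def bmEmbedding {Q : ℝ≥0∞} [Fact (1 ≤ Q)] (hQr : Q.toReal = r) :
    bmSpace p t r hp hr →ₗᵢ[ℂ] lp (fun _ : DyadicIndex n => mixedLp p hp) Q where
  toFun f := ⟨fun k => toMixedLp p hp (cubePart p t k f.1), memℓp_gen (by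
    simp_rw [hQr, norm_toMixedLp_cubePart]
    exact ENNReal.summable_toReal (tsum_cubePart_ne_top f))⟩
  map_add' f g := by
    ext1
    funext k
    change toMixedLp p hp _ = toMixedLp p hp _ + toMixedLp p hp _
    rw [← toMixedLp_add (memMixedLp_cubePart f k) (memMixedLp_cubePart g k)]
    refine toMixedLp_congr ((memMixedLp_cubePart f k).add hp (memMixedLp_cubePart g k))
      ((cubePart_congr k (AEEqFun.coeFn_add f.1 g.1)).trans (Eventually.of_forall fun x => ?_))
    by_cases hx : x ∈ dyadicCube k <;> simp [cubePart, hx, mul_add]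
  map_smul' a f := by
    ext1
    funext k
    change toMixedLp p hp _ = a • toMixedLp p hp _
    rw [← toMixedLp_smul a (memMixedLp_cubePart f k)]
    refine toMixedLp_congr ((memMixedLp_cubePart f k).smul hp a)
      ((cubePart_congr k (AEEqFun.coeFn_smul a f.1)).trans (Eventually.of_forall fun x => ?_))
    by_cases hx : x ∈ dyadicCube k <;> simp [cubePart, hx, mul_left_comm]
  norm_map' f := by
    change ‖(⟨fun k => toMixedLp p hp (cubePart p t k f.1), _⟩ : lp _ Q)‖ = _
    subst hQr
    rw [lp.norm_eq_tsum_rpow (zero_lt_one.trans hr), norm_def,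
      bmNorm_eq_tsum_cubePart hp hr, ← ENNReal.toReal_rpow, ENNReal.tsum_toReal_eq
        (ENNReal.ne_top_of_tsum_ne_top (tsum_cubePart_ne_top f))]
    exact congrArg (· ^ (1 / Q.toReal)) (tsum_congr fun k => norm_toMixedLp_cubePart f k)

theorem coe_bmEmbedding {Q : ℝ≥0∞} [Fact (1 ≤ Q)] (hQr : Q.toReal = r)
    (f : bmSpace p t r hp hr) (k : DyadicIndex n) :
    (bmEmbedding hQr f k).1 =ᵐ[volume] cubePart p t k f.1 :=
  coe_toMixedLp (memMixedLp_cubePart f k)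

variable (hr) in
/-- A function whose weighted restrictions to the dyadic cubes form an `ℓ^r` family lies in the mixed
Bourgain–Morrey space. -/
theorem exists_bmEmbedding_eq {Q : ℝ≥0∞} [Fact (1 ≤ Q)] (hQr : Q.toReal = r)
    (F : lp (fun _ : DyadicIndex n => mixedLp p hp) Q) {f : (Fin n → ℝ) → ℂ}
    (hf : AEStronglyMeasurable f volume) (hF : ∀ k, cubePart p t k f =ᵐ[volume] (F k).1) :
    ∃ f' : bmSpace p t r hp hr, f'.1 =ᵐ[volume] f ∧ bmEmbedding hQr f' = F := by
  have hr0 : 0 < r := zero_lt_one.trans hr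
  have hlt : bmNorm p t r (AEEqFun.mk f hf) < ∞ := by
    rw [bmNorm_congr p hp t r hr (AEEqFun.coeFn_mk f hf), bmNorm_eq_tsum_cubePart hp hr]
    refine ENNReal.rpow_lt_top_of_nonneg (one_div_nonneg.2 hr0.le) ?_
    have h1 (k) : mixedLpNorm p (cubePart p t k f) ^ r = ENNReal.ofReal (‖F k‖ ^ r) := by
      rw [mixedLpNorm_congr p hp (hF k), ← enorm_mixedLp, ← ofReal_norm,
        ENNReal.ofReal_rpow_of_nonneg (norm_nonneg _) hr0.le]
    have h2 := (lp.memℓp F).summable (by rw [hQr]; exact hr0)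
    rw [hQr] at h2
    simp_rw [h1]
    rw [← ENNReal.ofReal_tsum_of_nonneg (fun k => by positivity) h2]
    exact ENNReal.ofReal_ne_top
  refine ⟨⟨AEEqFun.mk f hf, hlt⟩, AEEqFun.coeFn_mk f hf, ?_⟩
  ext1
  funext k
  refine mixedLp_ext ((coe_bmEmbedding hQr _ k).trans
    ((cubePart_congr k (AEEqFun.coeFn_mk f hf)).trans (hF k)))

end Embedding

/-! ### The pairing of sequence spaces of mixed Lebesgue functions. -/

section Pairing

variable {n : ℕ} {p q : Fin n → ℝ}

theorem norm_mixedPairing_family_le (hp : ∀ i, 1 < p i) (hq : ∀ i, 1 < q i)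
    (hpq : ∀ i, (p i).HolderConjugate (q i)) (_ : DyadicIndex n) :
    ‖mixedPairing hp hq hpq‖ ≤ (1 : NNReal) := by
  simpa using norm_mixedPairing_le hp hq hpq

/-- The pairing between sequence spaces of mixed Lebesgue functions. -/
def seqPairing (hp : ∀ i, 1 < p i) (hq : ∀ i, 1 < q i)
    (hpq : ∀ i, (p i).HolderConjugate (q i)) (P Q : ℝ≥0∞) [Fact (1 ≤ P)] [Fact (1 ≤ Q)]
    [P.HolderConjugate Q] : lp (fun _ : DyadicIndex n => mixedLp q hq) P →L[ℂ]
      lp (fun _ : DyadicIndex n => mixedLp p hp) Q →L[ℂ] ℂ :=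
  lp.dualPairing P Q (fun _ => mixedPairing hp hq hpq) (norm_mixedPairing_family_le hp hq hpq)

variable {hp : ∀ i, 1 < p i} {hq : ∀ i, 1 < q i} {P Q : ℝ≥0∞} [P.HolderConjugate Q]

/-- Hölder's inequality in `x` for each cube, then in the sequence variable. This absolute
convergence justifies every later interchange of sum and integral. -/
theorem tsum_lintegral_enorm_mul_ne_top (hpq : ∀ i, (p i).HolderConjugate (q i)) (hP : P ≠ ∞)
    (hQ : Q ≠ ∞) (h : lp (fun _ : DyadicIndex n => mixedLp q hq) P)
    (F : lp (fun _ : DyadicIndex n => mixedLp p hp) Q) :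
    ∑' k, ∫⁻ x, ‖(F k).1 x * (h k).1 x‖ₑ ≠ ∞ := by
  have h1 : Summable fun k => ‖h k‖ * ‖F k‖ :=
    have hPQ := ENNReal.HolderConjugate.toReal_of_ne_top (p := P) (q := Q) hP hQ
    (Real.summable_mul_of_Lp_Lq_of_nonneg hPQ (fun k => norm_nonneg (h k))
      (fun k => norm_nonneg (F k)) ((lp.memℓp h).summable hPQ.pos)
      ((lp.memℓp F).summable hPQ.symm.pos))
  refine ne_top_of_le_ne_top ?_ (ENNReal.tsum_le_tsum (g := fun k =>
    ENNReal.ofReal (‖h k‖ * ‖F k‖)) fun k => ?_)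
  · rw [← ENNReal.ofReal_tsum_of_nonneg (fun k => by positivity) h1]
    exact ENNReal.ofReal_ne_top
  · rw [ENNReal.ofReal_mul (norm_nonneg _), ofReal_norm, ofReal_norm, mul_comm, enorm_mixedLp,
      enorm_mixedLp]
    exact lintegral_enorm_mul_le hpq (memMixedLp_coe _).1 (memMixedLp_coe _).1

theorem lintegral_tsum_enorm_mul_ne_top (hpq : ∀ i, (p i).HolderConjugate (q i)) (hP : P ≠ ∞)
    (hQ : Q ≠ ∞) (h : lp (fun _ : DyadicIndex n => mixedLp q hq) P)
    (F : lp (fun _ : DyadicIndex n => mixedLp p hp) Q) :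
    ∫⁻ x, ∑' k, ‖(F k).1 x * (h k).1 x‖ₑ ≠ ∞ := by
  rw [lintegral_tsum (f := fun k x => ‖(F k).1 x * (h k).1 x‖ₑ) fun k =>
    ((F k).1.measurable.mul (h k).1.measurable).enorm.aemeasurable]
  exact tsum_lintegral_enorm_mul_ne_top hpq hP hQ h F

variable [Fact (1 ≤ P)] [Fact (1 ≤ Q)]

theorem seqPairing_apply (hpq : ∀ i, (p i).HolderConjugate (q i))
    (h : lp (fun _ : DyadicIndex n => mixedLp q hq) P)
    (F : lp (fun _ : DyadicIndex n => mixedLp p hp) Q) :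
    seqPairing hp hq hpq P Q h F = ∑' k, ∫ x, (F k).1 x * (h k).1 x :=
  lp.dualPairing_apply ..

theorem norm_seqPairing_le (hpq : ∀ i, (p i).HolderConjugate (q i))
    (h : lp (fun _ : DyadicIndex n => mixedLp q hq) P)
    (F : lp (fun _ : DyadicIndex n => mixedLp p hp) Q) :
    ‖seqPairing hp hq hpq P Q h F‖ ≤ ‖h‖ * ‖F‖ := by
  have h1 : ‖seqPairing hp hq hpq P Q‖ ≤ (1 : NNReal) :=
    lp.norm_dualPairing _ (norm_mixedPairing_family_le hp hq hpq)
  have h2 := (seqPairing hp hq hpq P Q).le_of_opNorm_le h1 h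
  rw [NNReal.coe_one, one_mul] at h2
  exact (seqPairing hp hq hpq P Q h).le_of_opNorm_le h2 F

theorem exists_seqPairing_eq (hpq : ∀ i, (p i).HolderConjugate (q i)) (hP : P ≠ ∞) (hQ : Q ≠ ∞)
    (L : StrongDual ℂ (lp (fun _ : DyadicIndex n => mixedLp p hp) Q)) :
    ∃ h : lp (fun _ : DyadicIndex n => mixedLp q hq) P, ‖h‖ ≤ ‖L‖ ∧
      L = seqPairing hp hq hpq P Q h :=
  exists_dualPairing_eq P Q hP hQ (mixedPairing hp hq hpq)
    (norm_mixedPairing_family_le hp hq hpq) (mixedPairing_surjective hp hq hpq)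
    (exists_mixedPairing_eq_norm hp hq hpq) L

theorem seqPairing_eq_integral_tsum (hpq : ∀ i, (p i).HolderConjugate (q i)) (hP : P ≠ ∞)
    (hQ : Q ≠ ∞) (h : lp (fun _ : DyadicIndex n => mixedLp q hq) P)
    (F : lp (fun _ : DyadicIndex n => mixedLp p hp) Q) :
    seqPairing hp hq hpq P Q h F = ∫ x, ∑' k, (F k).1 x * (h k).1 x := by
  have hi (k) : Integrable fun x => (F k).1 x * (h k).1 x :=
    (memMixedLp_coe _).integrable_mul hpq (memMixedLp_coe _)
  rw [seqPairing_apply]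
  refine (hasSum_integral_of_summable_integral_norm hi ?_).tsum_eq
  simp_rw [fun k => integral_norm_eq_lintegral_enorm (hi k).1]
  exact ENNReal.summable_toReal (tsum_lintegral_enorm_mul_ne_top hpq hP hQ h F)

end Pairing

/-! ### Families, block expansions and represented functionals. -/

section Representation

variable {n : ℕ} {p q : Fin n → ℝ} {t r : ℝ} {hp : ∀ i, 1 < p i} {hq : ∀ i, 1 < q i} {hr : 1 < r}

/-- The mixed Bourgain–Morrey space contains bounded functions supported on unit cubes. -/
theorem exists_bmSpace_unitCube (hn : 1 < (n : ℝ) / ∑ i, 1 / p i)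
    (ht : (n : ℝ) / ∑ i, 1 / p i < t) (htr : t < r) (m : Fin n → ℤ) {s : (Fin n → ℝ) → ℂ}
    (hs : Measurable s) (hs1 : ∀ x, ‖s x‖ₑ ≤ 1) :
    ∃ f : bmSpace p t r hp hr, f.1 =ᵐ[volume] (dyadicCube (0, m)).indicator s := by
  have hm := (hs.indicator (measurableSet_dyadicCube (0, m))).aestronglyMeasurable (μ := volume)
  refine ⟨⟨AEEqFun.mk _ hm, ?_⟩, AEEqFun.coeFn_mk _ hm⟩
  change bmNorm p t r _ < ∞
  rw [bmNorm_congr p hp t r hr (AEEqFun.coeFn_mk _ hm)]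
  refine (bmNorm_mono p hp t r hr (Eventually.of_forall fun x => ?_)).trans_lt
    (bmNorm_unitCube_lt_top p t r hp hn ht htr m)
  by_cases hx : x ∈ dyadicCube (0, m) <;> simp [hx, hs1 x]

/-- Testing with the conjugate phase of `g - g'` on a unit cube gives `∫ |g - g'| = 0` over that
cube, and countably many unit cubes cover the space. -/
theorem aeEqFun_eq_of_forall_integral_mul_eq (hn : 1 < (n : ℝ) / ∑ i, 1 / p i)
    (ht : (n : ℝ) / ∑ i, 1 / p i < t) (htr : t < r) {g g' : (Fin n → ℝ) →ₘ[volume] ℂ}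
    (hg : ∀ f : bmSpace p t r hp hr, Integrable fun x => f.1 x * g x)
    (hg' : ∀ f : bmSpace p t r hp hr, Integrable fun x => f.1 x * g' x)
    (h : ∀ f : bmSpace p t r hp hr, ∫ x, f.1 x * g x = ∫ x, f.1 x * g' x) : g = g' := by
  obtain ⟨s, hs, hs1, hs2⟩ := exists_unimodular_mul_eq_norm
    (h := fun x => g x - g' x) (g.measurable.sub g'.measurable)
  have hcube (m : Fin n → ℤ) : ∀ᵐ x, x ∈ dyadicCube (0, m) → g x = g' x := by
    obtain ⟨f, hf⟩ := exists_bmSpace_unitCube (hp := hp) (hr := hr) hn ht htr m hs hs1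
    have h1 : (fun x => f.1 x * g x - f.1 x * g' x) =ᵐ[volume]
        fun x => (((dyadicCube (0, m)).indicator (fun x => ‖g x - g' x‖) x : ℝ) : ℂ) := by
      filter_upwards [hf] with x hx
      rw [hx, ← mul_sub]
      by_cases hx' : x ∈ dyadicCube (0, m)
      · simp only [Set.indicator_of_mem hx', hs2]
      · simp [hx']
    have hint := ((hg f).sub (hg' f)).congr h1
    have h2 : ∫ x, (dyadicCube (0, m)).indicator (fun x => ‖g x - g' x‖) x = 0 := by
      have h3 := integral_congr_ae h1
      rw [integral_sub (hg f) (hg' f), h f, sub_self, integral_complex_ofReal] at h3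
      exact_mod_cast h3.symm
    rw [integral_eq_zero_iff_of_nonneg
      (fun x => Set.indicator_nonneg (fun _ _ => norm_nonneg _) x) (by simpa using hint.re)] at h2
    filter_upwards [h2] with x hx hx'
    rw [Set.indicator_of_mem hx', Pi.zero_apply, norm_eq_zero, sub_eq_zero] at hx
    exact hx
  refine AEEqFun.ext ?_
  filter_upwards [ae_all_iff.2 hcube] with x hx
  exact hx _ (mem_dyadicCube_zero_floor x)

variable {P Q : ℝ≥0∞}

variable (p t) in
/-- `g` is the sum of the weighted restrictions of the family `h` to the dyadic cubes. -/
def IsSynthesis (h : lp (fun _ : DyadicIndex n => mixedLp q hq) P)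
    (g : (Fin n → ℝ) → ℂ) : Prop :=
  ∀ᵐ x, HasSum (fun k => cubePart p t k (h k).1 x) (g x)

/-- Blocks and coefficients give an `ℓ^{r'}` family of mixed Lebesgue functions. -/
theorem IsAdmissible.exists_isSynthesis (hr : 1 < r) (hP : P.toReal = r.conjExponent)
    (hq' : ∀ i, 1 < (p i).conjExponent)
    {g : (Fin n → ℝ) →ₘ[volume] ℂ} {c : DyadicIndex n → ℂ} (hc : IsAdmissible p t r g c) :
    ∃ h : lp (fun _ : DyadicIndex n => mixedLp (fun i => (p i).conjExponent) hq') P,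
      IsSynthesis p t h g ∧ ‖h‖ ≤ (∑' k, ‖c k‖ ^ r.conjExponent) ^ (1 / r.conjExponent) := by
  obtain ⟨hcs, b, hb, hsum⟩ := hc
  have hP0 : 0 < P.toReal := by
    rw [hP]
    exact (Real.HolderConjugate.conjExponent hr).symm.pos
  rw [← hP] at hcs ⊢
  -- The block condition is `‖b k‖ ≤ cubeWeight p t k`, so `c k * b k` divided by the weight has
  -- norm at most `‖c k‖`. Weighted restriction restores `c k * b k`.
  set a : DyadicIndex n → ℂ := fun k => c k * (cubeWeight p t k : ℂ)⁻¹ with ha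
  have hmem (k) : MemMixedLp (fun i => (p i).conjExponent) (b k) := by
    refine ⟨(hb k).1, (hb k).2.2.trans_lt ?_⟩
    rw [← ofReal_cubeWeight]
    exact ENNReal.ofReal_lt_top
  set h : DyadicIndex n → mixedLp (fun i => (p i).conjExponent) hq' :=
    fun k => toMixedLp _ hq' (a k • b k) with hh
  have hnorm (k) : ‖h k‖ ≤ ‖c k‖ := by
    rw [← enorm_le_iff_norm_le, hh, enorm_toMixedLp ((hmem k).smul hq' _),
      mixedLpNorm_smul _ hq', ha, enorm_mul, mul_assoc]
    refine mul_le_of_le_one_right' ?_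
    rw [enorm_inv (cubeWeight_ne_zero k), enorm_cubeWeight]
    exact (mul_le_mul_right (hb k).2.2 _).trans (ENNReal.inv_mul_le_one _)
  have hpow (k) : ‖h k‖ ^ P.toReal ≤ ‖c k‖ ^ P.toReal :=
    Real.rpow_le_rpow (norm_nonneg _) (hnorm k) hP0.le
  have hhs : Summable fun k => ‖h k‖ ^ P.toReal :=
    Summable.of_nonneg_of_le (fun k => by positivity) hpow hcs
  refine ⟨⟨h, memℓp_gen hhs⟩, ?_, ?_⟩
  · have hk (k) : cubePart p t k (h k).1 =ᵐ[volume] fun x => c k * b k x := by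
      filter_upwards [coe_toMixedLp (hp := hq') ((hmem k).smul hq' (a k)), (hb k).2.1]
        with x h1 h2
      by_cases hx : x ∈ dyadicCube k
      · rw [cubePart_of_mem hx, h1, Pi.smul_apply, smul_eq_mul, ha]
        have := cubeWeight_ne_zero (p := p) (t := t) k
        field_simp
      · rw [cubePart_of_notMem hx, h2 hx, mul_zero]
    filter_upwards [hsum, ae_all_iff.2 hk] with x h1 h2
    change HasSum (fun k => cubePart p t k (h k).1 x) (g x)
    simp_rw [h2]
    exact h1
  · rw [lp.norm_eq_tsum_rpow hP0]
    exact Real.rpow_le_rpow (tsum_nonneg fun k => by positivity) (hhs.tsum_le_tsum hpow hcs)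
      (one_div_nonneg.2 hP0.le)

/-- An `ℓ^{r'}` family of mixed Lebesgue functions is a family of multiples of blocks. -/
theorem IsSynthesis.exists_isAdmissible (hr : 1 < r) (hP : P.toReal = r.conjExponent)
    {hq' : ∀ i, 1 < (p i).conjExponent} {g : (Fin n → ℝ) →ₘ[volume] ℂ}
    {h : lp (fun _ : DyadicIndex n => mixedLp (fun i => (p i).conjExponent) hq') P}
    (hg : IsSynthesis p t h g) :
    ∃ c, IsAdmissible p t r g c ∧
      (∑' k, ‖c k‖ ^ r.conjExponent) ^ (1 / r.conjExponent) = ‖h‖ := by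
  have hP0 : 0 < P.toReal := by
    rw [hP]
    exact (Real.HolderConjugate.conjExponent hr).symm.pos
  have hcn (k) : ‖((‖h k‖ : ℝ) : ℂ)‖ = ‖h k‖ := by simp
  have hs := (lp.memℓp h).summable hP0
  -- The coefficient is `‖h k‖` and the block is the normalised weighted restriction. If `‖h k‖ = 0`
  -- the inverse is `0` and the block is zero, which loses nothing since `h k` then vanishes almost
  -- everywhere.
  refine ⟨fun k => (‖h k‖ : ℂ), ⟨?_, fun k => (‖h k‖⁻¹ : ℂ) • cubePart p t k (h k).1,
    fun k => ⟨?_, ?_, ?_⟩, ?_⟩, ?_⟩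
  · simp_rw [hcn, ← hP]
    exact hs
  · exact (aestronglyMeasurable_cubePart k (h k).1.aestronglyMeasurable).const_smul _
  · refine Eventually.of_forall fun x hx => ?_
    beta_reduce
    rw [Pi.smul_apply, cubePart_of_notMem hx, smul_zero]
  · rw [mixedLpNorm_smul _ hq']
    rcases eq_or_ne ‖h k‖ 0 with h0 | h0
    · simp [h0]
    · refine (mul_le_mul_right (mixedLpNorm_cubePart_le hq' k _) _).trans ?_
      rw [← enorm_mixedLp, mul_left_comm]
      refine mul_le_of_le_one_right' ?_
      rw [enorm_inv (by exact_mod_cast h0), ← ofReal_norm, hcn, ofReal_norm]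
      exact ENNReal.inv_mul_le_one _
  · have hz (k) : ∀ᵐ x, ‖h k‖ = 0 → (h k).1 x = 0 := by
      rcases eq_or_ne ‖h k‖ 0 with h0 | h0
      · rw [norm_eq_zero] at h0
        rw [h0]
        filter_upwards [mixedLp_coe_zero (hp := hq')] with x hx _
        exact hx
      · exact Eventually.of_forall fun x hx => absurd hx h0
    filter_upwards [hg, ae_all_iff.2 hz] with x h1 h2
    convert h1 using 2 with k
    rw [Pi.smul_apply, smul_eq_mul]
    rcases eq_or_ne ‖h k‖ 0 with h0 | h0
    · by_cases hx : x ∈ dyadicCube k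
      · rw [cubePart_of_mem hx, h2 k h0]
        simp
      · rw [cubePart_of_notMem hx]
        simp
    · have : (‖h k‖ : ℂ) ≠ 0 := by exact_mod_cast h0
      rw [mul_inv_cancel_left₀ this]
  · simp_rw [hcn]
    rw [lp.norm_eq_tsum_rpow hP0, hP]

variable [Fact (1 ≤ Q)]

theorem ae_bmEmbedding_mul (hQr : Q.toReal = r) (f : bmSpace p t r hp hr)
    (h : lp (fun _ : DyadicIndex n => mixedLp q hq) P) :
    ∀ᵐ x, ∀ k, (bmEmbedding hQr f k).1 x * (h k).1 x = f.1 x * cubePart p t k (h k).1 x := by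
  rw [ae_all_iff]
  intro k
  filter_upwards [coe_bmEmbedding hQr f k] with x hx
  rw [hx, cubePart_mul]

variable [P.HolderConjugate Q]

/-- Pairing `h` with the embedded indicator of a unit cube gives a sum of absolute values with
finite integral. Hence the synthesis series converges absolutely almost everywhere on that cube, and
unit cubes cover the space. -/
theorem exists_isSynthesis (hr : 1 < r) (hpq : ∀ i, (p i).HolderConjugate (q i))
    (hn : 1 < (n : ℝ) / ∑ i, 1 / p i) (ht : (n : ℝ) / ∑ i, 1 / p i < t) (htr : t < r)
    (hP : P ≠ ∞) (hQ : Q ≠ ∞) (hQr : Q.toReal = r)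
    (h : lp (fun _ : DyadicIndex n => mixedLp q hq) P) :
    ∃ g : (Fin n → ℝ) →ₘ[volume] ℂ, IsSynthesis p t h g := by
  have hp (i) : 1 < p i := (hpq i).lt
  have hcube (m : Fin n → ℤ) : ∀ᵐ x, x ∈ dyadicCube (0, m) →
      Summable fun k => cubePart p t k (h k).1 x := by
    obtain ⟨f, hf⟩ := exists_bmSpace_unitCube (hp := hp) (hr := hr) hn ht htr m
      (s := fun _ => 1) measurable_const (fun x => by simp)
    have h1 := ae_lt_top' (AEMeasurable.tsum fun k =>
      (((bmEmbedding hQr f k).1.measurable.mul (h k).1.measurable).enorm).aemeasurable)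
      (lintegral_tsum_enorm_mul_ne_top hpq hP hQ h (bmEmbedding hQr f))
    filter_upwards [h1, hf, ae_bmEmbedding_mul hQr f h] with x hx hfx hxk hxm
    rw [Set.indicator_of_mem hxm] at hfx
    refine Summable.of_enorm ?_
    simp only [Pi.mul_apply, hxk, hfx, one_mul] at hx
    exact hx.ne
  have hsum : ∀ᵐ x, HasSum (fun k => cubePart p t k (h k).1 x)
      (∑' k, cubePart p t k (h k).1 x) := by
    filter_upwards [ae_all_iff.2 hcube] with x hx
    exact (hx _ (mem_dyadicCube_zero_floor x)).hasSum
  have hm : AEStronglyMeasurable (fun x => ∑' k, cubePart p t k (h k).1 x) volume :=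
    aestronglyMeasurable_of_tendsto_ae atTop
      (f := fun (s : Finset (DyadicIndex n)) x => ∑ k ∈ s, cubePart p t k (h k).1 x)
      (fun s => Finset.aestronglyMeasurable_fun_sum s fun k _ =>
        aestronglyMeasurable_cubePart k (h k).1.aestronglyMeasurable) hsum
  refine ⟨AEEqFun.mk _ hm, ?_⟩
  filter_upwards [hsum, AEEqFun.coeFn_mk _ hm] with x h1 h2
  rwa [h2]

variable [Fact (1 ≤ P)]

theorem IsSynthesis.integrable_and_integral_eq (hpq : ∀ i, (p i).HolderConjugate (q i))
    (hP : P ≠ ∞) (hQ : Q ≠ ∞) (hQr : Q.toReal = r)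
    {h : lp (fun _ : DyadicIndex n => mixedLp q hq) P} {g : (Fin n → ℝ) →ₘ[volume] ℂ}
    (hg : IsSynthesis p t h g) (f : bmSpace p t r hp hr) :
    Integrable (fun x => f.1 x * g x) ∧
      seqPairing hp hq hpq P Q h (bmEmbedding hQr f) = ∫ x, f.1 x * g x := by
  have hs : ∀ᵐ x, ∑' k, (bmEmbedding hQr f k).1 x * (h k).1 x = f.1 x * g x := by
    filter_upwards [hg, ae_bmEmbedding_mul hQr f h] with x h1 h2
    simp_rw [h2]
    exact (h1.mul_left _).tsum_eq
  constructor
  · refine ⟨f.1.aestronglyMeasurable.mul g.aestronglyMeasurable, ?_⟩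
    refine lt_of_le_of_lt (lintegral_mono_ae ?_)
      (lintegral_tsum_enorm_mul_ne_top hpq hP hQ h (bmEmbedding hQr f)).lt_top
    filter_upwards [hs] with x hx
    rw [← hx]
    exact enorm_tsum_le_tsum_enorm
  · rw [seqPairing_eq_integral_tsum hpq hP hQ]
    exact integral_congr_ae hs

/-- Hahn–Banach: `L` is transported to the range of the isometric embedding and extended to the
whole sequence space without increasing its norm. -/
theorem exists_seqPairing_bmEmbedding_eq (hpq : ∀ i, (p i).HolderConjugate (q i)) (hP : P ≠ ∞)
    (hQ : Q ≠ ∞) (hQr : Q.toReal = r) (L : StrongDual ℂ (bmSpace p t r hp hr)) :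
    ∃ h : lp (fun _ : DyadicIndex n => mixedLp q hq) P, ‖h‖ ≤ ‖L‖ ∧
      ∀ f, L f = seqPairing hp hq hpq P Q h (bmEmbedding hQr f) := by
  set J := bmEmbedding (hp := hp) (hr := hr) (t := t) hQr
  set e := J.equivRange
  obtain ⟨L', hL', hn'⟩ := exists_extension_norm_eq (LinearMap.range J.toLinearMap)
    (L.comp (e.symm.toContinuousLinearEquiv : _ →L[ℂ] bmSpace p t r hp hr))
  obtain ⟨h, hh, hLh⟩ := exists_seqPairing_eq (hq := hq) (P := P) hpq hP hQ L'
  refine ⟨h, hh.trans ?_, fun f => ?_⟩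
  · rw [hn']
    refine ContinuousLinearMap.opNorm_le_bound _ (norm_nonneg L) fun x => ?_
    refine (L.le_opNorm _).trans (le_of_eq ?_)
    congr 1
    exact e.symm.norm_map x
  · rw [← hLh]
    have := hL' (e f)
    simp only [ContinuousLinearMap.coe_comp, Function.comp_apply] at this
    refine Eq.trans ?_ this.symm
    congr 1
    exact (e.symm_apply_apply f).symm

end Representation

/-! ### Reflexivity. -/

section Reflexivity

variable {n : ℕ} {p q : Fin n → ℝ} {t r : ℝ} {hp : ∀ i, 1 < p i} {hq : ∀ i, 1 < q i}

/-- The norm of `F χ_A` is attained against some `φ`, and replacing `φ` by `φ χ_A` does not change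
that pairing. -/
theorem ae_eq_zero_of_forall_mixedPairing_eq_zero (hpq : ∀ i, (p i).HolderConjugate (q i))
    {F : (Fin n → ℝ) → ℂ} (hF : MemMixedLp p F) {A : Set (Fin n → ℝ)} (hA : MeasurableSet A)
    (h : ∀ φ, MemMixedLp q φ → (∀ x, x ∉ A → φ x = 0) → ∫ x, φ x * F x = 0) :
    ∀ᵐ x, x ∈ A → F x = 0 := by
  have hp (i) : 1 < p i := (hpq i).lt
  have hq (i) : 1 < q i := (hpq i).symm.lt
  have hFA : MemMixedLp p (A.indicator F) :=
    hF.mono hp (hF.1.indicator hA) (Eventually.of_forall fun x => by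
      by_cases hx : x ∈ A <;> simp [hx])
  obtain ⟨φ, -, hφ⟩ := exists_mixedPairing_eq_norm hq hp (fun i => (hpq i).symm)
    (toMixedLp p hp (A.indicator F))
  have h1 : ∫ x, φ.1 x * (toMixedLp p hp (A.indicator F)).1 x = 0 := by
    rw [← h (A.indicator φ.1) ((memMixedLp_coe φ).mono hq ((memMixedLp_coe φ).1.indicator hA)
      (Eventually.of_forall fun x => by by_cases hx : x ∈ A <;> simp [hx]))
      (fun x hx => Set.indicator_of_notMem hx _)]
    refine integral_congr_ae ?_
    filter_upwards [coe_toMixedLp (hp := hp) hFA] with x hx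
    rw [hx]
    by_cases hxA : x ∈ A <;> simp [hxA]
  rw [mixedPairing_apply, h1] at hφ
  have h2 : toMixedLp p hp (A.indicator F) = 0 := norm_eq_zero.1 (by exact_mod_cast hφ.symm)
  filter_upwards [coe_toMixedLp (hp := hp) hFA, h2 ▸ mixedLp_coe_zero (hp := hp)] with x h3 h4 hx
  rw [Set.indicator_of_mem hx] at h3
  rw [← h3]
  exact h4

theorem measurable_comp_floor {G : (Fin n → ℤ) → (Fin n → ℝ) → ℂ} (hG : ∀ m, Measurable (G m)) :
    Measurable fun x : Fin n → ℝ => G (fun i => ⌊x i⌋) x := by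
  have h1 : Measurable (Function.uncurry G) := measurable_from_prod_countable_right hG
  have h2 : Measurable fun x : Fin n → ℝ => ((fun i => ⌊x i⌋ : Fin n → ℤ), x) :=
    (measurable_pi_lambda _ fun i => (measurable_pi_apply i).floor).prodMk measurable_id
  exact h1.comp h2

/-- Compatible functions on the dyadic cubes are the weighted restrictions of a single function. -/
theorem exists_cubePart_ae_eq (p : Fin n → ℝ) (t : ℝ) {F : DyadicIndex n → (Fin n → ℝ) → ℂ}
    (hF : ∀ k, Measurable (F k)) (h0 : ∀ k, ∀ᵐ x, x ∉ dyadicCube k → F k x = 0)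
    (hc : ∀ k l, ∀ᵐ x, x ∈ dyadicCube k ∩ dyadicCube l →
      (cubeWeight p t k : ℂ)⁻¹ * F k x = (cubeWeight p t l : ℂ)⁻¹ * F l x) :
    ∃ f : (Fin n → ℝ) → ℂ, Measurable f ∧ ∀ k, cubePart p t k f =ᵐ[volume] F k := by
  -- The function is read off from the unit cube containing `x`. Compatibility of that cube with `k`
  -- then gives the correct values on every cube `k`, larger or smaller.
  refine ⟨fun x => (cubeWeight p t (0, fun i => ⌊x i⌋) : ℂ)⁻¹ * F (0, fun i => ⌊x i⌋) x, ?_,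
    fun k => ?_⟩
  · exact measurable_comp_floor (G := fun m x =>
      (cubeWeight p t (0, m) : ℂ)⁻¹ * F (0, m) x) fun m => (hF (0, m)).const_mul _
  · filter_upwards [h0 k, ae_all_iff.2 fun l => hc l k] with x h1 h2
    by_cases hx : x ∈ dyadicCube k
    · rw [cubePart_of_mem hx, h2 _ ⟨mem_dyadicCube_zero_floor x, hx⟩,
        mul_inv_cancel_left₀ (cubeWeight_ne_zero k)]
    · rw [cubePart_of_notMem hx, h1 hx]

variable {hr : 1 < r} {P Q : ℝ≥0∞} [Fact (1 ≤ P)] [Fact (1 ≤ Q)] [P.HolderConjugate Q]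

/-- The map sending an `ℓ^{r'}` family of mixed Lebesgue functions to the functional on the mixed
Bourgain–Morrey space that it defines. -/
def familyDual (hpq : ∀ i, (p i).HolderConjugate (q i)) (hQr : Q.toReal = r) :
    lp (fun _ : DyadicIndex n => mixedLp q hq) P →L[ℂ] StrongDual ℂ (bmSpace p t r hp hr) :=
  (ContinuousLinearMap.precomp ℂ (bmEmbedding hQr).toContinuousLinearMap).comp
    (seqPairing hp hq hpq P Q)

theorem familyDual_apply (hpq : ∀ i, (p i).HolderConjugate (q i)) (hQr : Q.toReal = r)
    (h : lp (fun _ : DyadicIndex n => mixedLp q hq) P) (f : bmSpace p t r hp hr) :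
    familyDual hpq hQr h f = seqPairing hp hq hpq P Q h (bmEmbedding hQr f) := rfl

theorem familyDual_single (hpq : ∀ i, (p i).HolderConjugate (q i)) (hQr : Q.toReal = r)
    (k : DyadicIndex n) {φ : (Fin n → ℝ) → ℂ} (hφ : MemMixedLp q φ) (f : bmSpace p t r hp hr) :
    familyDual hpq hQr (lp.single P k (toMixedLp q hq φ)) f =
      ∫ x, f.1 x * cubePart p t k φ x := by
  rw [familyDual_apply, seqPairing_apply, tsum_eq_single k]
  · refine integral_congr_ae ?_
    filter_upwards [coe_bmEmbedding hQr f k, coe_toMixedLp (hp := hq) hφ] with x h1 h2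
    rw [lp.single_apply_self, h1, h2, cubePart_mul]
  · intro l hl
    rw [lp.single_apply_ne P k _ hl]
    refine integral_eq_zero_of_ae ?_
    filter_upwards [mixedLp_coe_zero (hp := hq)] with x hx
    rw [hx]
    simp

theorem seqPairing_single (hpq : ∀ i, (p i).HolderConjugate (q i))
    (k : DyadicIndex n) {φ : (Fin n → ℝ) → ℂ} (hφ : MemMixedLp p φ)
    (F : lp (fun _ : DyadicIndex n => mixedLp q hq) P) :
    seqPairing hp hq hpq P Q F (lp.single Q k (toMixedLp p hp φ)) = ∫ x, φ x * (F k).1 x := by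
  rw [seqPairing_apply, tsum_eq_single k]
  · refine integral_congr_ae ?_
    filter_upwards [coe_toMixedLp (hp := hp) hφ] with x h2
    rw [lp.single_apply_self, h2]
  · intro l hl
    rw [lp.single_apply_ne Q k _ hl]
    refine integral_eq_zero_of_ae ?_
    filter_upwards [mixedLp_coe_zero (hp := hp)] with x hx
    rw [hx]
    simp

/-- `Φ ∘ T` is a functional on `ℓ^{r'}(L^{p'})`, hence pairing with some `F`. Its vanishing on the
kernel of `T` forces `F` into the range of the embedding. -/
theorem inclusionInDoubleDual_surjective (hpq : ∀ i, (p i).HolderConjugate (q i)) (hq : ∀ i, 1 < q i)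
    (hP : P ≠ ∞) (hQ : Q ≠ ∞) (hQr : Q.toReal = r) :
    Function.Surjective (NormedSpace.inclusionInDoubleDual ℂ (bmSpace p t r hp hr)) := by
  intro Φ
  have hqp (i) : (q i).HolderConjugate (p i) := (hpq i).symm
  have _ : Q.HolderConjugate P := ENNReal.HolderConjugate.symm
  set T := familyDual (hp := hp) (hq := hq) (hr := hr) (t := t) (P := P) hpq hQr with hT
  obtain ⟨F, -, hF⟩ := exists_seqPairing_eq (hp := hq) (hq := hp) (P := Q) (Q := P) hqp hQ hP
    (Φ.comp T)
  have hΦ (h) : Φ (T h) = seqPairing hq hp hqp Q P F h := congrArg (fun L => L h) hF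
  have hΦs (k : DyadicIndex n) {φ : (Fin n → ℝ) → ℂ} (hφ : MemMixedLp q φ) :
      Φ (T (lp.single P k (toMixedLp q hq φ))) = ∫ x, φ x * (F k).1 x := by
    rw [hΦ, seqPairing_single hqp k hφ]
  -- A single-entry family at `k` supported off the cube lies in the kernel of `T`.
  have h0 (k) : ∀ᵐ x, x ∉ dyadicCube k → (F k).1 x = 0 := by
    refine ae_eq_zero_of_forall_mixedPairing_eq_zero hpq (memMixedLp_coe (F k))
      (measurableSet_dyadicCube k).compl fun φ hφ hφ0 => ?_
    have h1 : T (lp.single P k (toMixedLp q hq φ)) = 0 := by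
      ext f
      rw [hT, familyDual_single hpq hQr k hφ]
      refine integral_eq_zero_of_ae (Eventually.of_forall fun x => ?_)
      by_cases hx : x ∈ dyadicCube k
      · simp [cubePart_of_mem hx, hφ0 x (fun h => h hx)]
      · simp [cubePart_of_notMem hx]
    rw [← hΦs k hφ, h1, map_zero]
  -- For `φ` supported in the intersection, placing `φ / w_k` in slot `k` or `φ / w_l` in slot `l`
  -- gives the same functional, namely integration against `φ`. Applying `Φ` to both compares `F k`
  -- and `F l`.
  have hc (k l) : ∀ᵐ x, x ∈ dyadicCube k ∩ dyadicCube l →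
      (cubeWeight p t k : ℂ)⁻¹ * (F k).1 x = (cubeWeight p t l : ℂ)⁻¹ * (F l).1 x := by
    have hk := (memMixedLp_coe (F k)).smul hp (cubeWeight p t k : ℂ)⁻¹
    have hl := (memMixedLp_coe (F l)).smul hp (-(cubeWeight p t l : ℂ)⁻¹)
    have h1 := ae_eq_zero_of_forall_mixedPairing_eq_zero hpq (hk.add hp hl)
      ((measurableSet_dyadicCube k).inter (measurableSet_dyadicCube l)) fun φ hφ hφ0 => ?_
    · filter_upwards [h1] with x hx hxkl
      have := hx hxkl
      simp only [Pi.add_apply, Pi.smul_apply, smul_eq_mul] at this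
      linear_combination this
    · have h2 : T (lp.single P k (toMixedLp q hq ((cubeWeight p t k : ℂ)⁻¹ • φ))) =
          T (lp.single P l (toMixedLp q hq ((cubeWeight p t l : ℂ)⁻¹ • φ))) := by
        ext f
        rw [hT, familyDual_single hpq hQr k (hφ.smul hq _),
          familyDual_single hpq hQr l (hφ.smul hq _)]
        have h3 (k' : DyadicIndex n) (hk' : ∀ x, x ∉ dyadicCube k' → φ x = 0) (x) :
            cubePart p t k' ((cubeWeight p t k' : ℂ)⁻¹ • φ) x = φ x := by
          by_cases hx : x ∈ dyadicCube k'
          · rw [cubePart_of_mem hx, Pi.smul_apply, smul_eq_mul,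
              mul_inv_cancel_left₀ (cubeWeight_ne_zero k')]
          · rw [cubePart_of_notMem hx, hk' x hx]
        simp_rw [h3 k fun x hx => hφ0 x fun h => hx h.1, h3 l fun x hx => hφ0 x fun h => hx h.2]
      have h4 := congrArg Φ h2
      rw [hΦs k (hφ.smul hq _), hΦs l (hφ.smul hq _)] at h4
      have hik := (hφ.smul hq (cubeWeight p t k : ℂ)⁻¹).integrable_mul hqp (memMixedLp_coe (F k))
      have hil := (hφ.smul hq (cubeWeight p t l : ℂ)⁻¹).integrable_mul hqp (memMixedLp_coe (F l))
      rw [← sub_eq_zero, ← integral_sub hik hil] at h4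
      rw [← h4]
      refine integral_congr_ae (Eventually.of_forall fun x => ?_)
      simp only [Pi.add_apply, Pi.smul_apply, smul_eq_mul]
      ring
  obtain ⟨f, hf, hfF⟩ := exists_cubePart_ae_eq p t (fun k => (F k).1.measurable) h0 hc
  obtain ⟨f', -, hJ⟩ := exists_bmEmbedding_eq hr hQr F hf.aestronglyMeasurable hfF
  refine ⟨f', ?_⟩
  ext L
  -- Every functional has the form `T h`, so the formula for `Φ ∘ T` determines `Φ`.
  obtain ⟨h, -, hh⟩ := exists_seqPairing_bmEmbedding_eq (hq := hq) (P := P) hpq hP hQ hQr L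
  have hL : L = T h := by
    ext f
    exact hh f
  rw [NormedSpace.dual_def, hh, hJ, hL, hΦ, seqPairing_apply, seqPairing_apply]
  simp_rw [mul_comm]

end Reflexivity

/-! ### Duality with the block space. -/

section Duality

variable {n : ℕ} {p : Fin n → ℝ} {t r : ℝ} {hp : ∀ i, 1 < p i} {hr : 1 < r}

theorem one_le_ofReal_conjExponent (hr : 1 < r) : 1 ≤ ENNReal.ofReal r.conjExponent :=
  ENNReal.one_le_ofReal.2 (Real.HolderConjugate.conjExponent hr).symm.lt.le

theorem toReal_ofReal_conjExponent (hr : 1 < r) :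
    (ENNReal.ofReal r.conjExponent).toReal = r.conjExponent :=
  ENNReal.toReal_ofReal (Real.HolderConjugate.conjExponent hr).symm.nonneg

theorem blockNorm_le_of_isAdmissible {g : (Fin n → ℝ) →ₘ[volume] ℂ} {c : DyadicIndex n → ℂ}
    (hc : IsAdmissible p t r g c) :
    blockNorm p t r g ≤ (∑' k, ‖c k‖ ^ r.conjExponent) ^ (1 / r.conjExponent) := by
  refine csInf_le ⟨0, ?_⟩ ⟨c, hc, rfl⟩
  rintro _ ⟨c, -, rfl⟩
  positivity

theorem integrable_of_mem_blockSpace (hp : ∀ i, 1 < p i) (hr : 1 < r)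
    {g : (Fin n → ℝ) →ₘ[volume] ℂ} (hg : g ∈ blockSpace p t r) (f : bmSpace p t r hp hr) :
    Integrable fun x => f.1 x * g x := by
  have _ : Fact (1 ≤ ENNReal.ofReal r.conjExponent) := ⟨one_le_ofReal_conjExponent hr⟩
  have _ : Fact (1 ≤ ENNReal.ofReal r) := ⟨ENNReal.one_le_ofReal.2 hr.le⟩
  have _ := (Real.HolderConjugate.conjExponent hr).symm.ennrealOfReal
  have hpq (i) : (p i).HolderConjugate (p i).conjExponent := .conjExponent (hp i)
  obtain ⟨c, hc⟩ := hg
  obtain ⟨h, hh, -⟩ := hc.exists_isSynthesis hr (toReal_ofReal_conjExponent hr)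
    (fun i => (hpq i).symm.lt)
  exact (hh.integrable_and_integral_eq hpq ENNReal.ofReal_ne_top ENNReal.ofReal_ne_top
    (ENNReal.toReal_ofReal (zero_lt_one.trans hr).le) f).1

/-- A functional on the mixed Bourgain–Morrey space is integration against an element of the block
space whose norm is at most that of the functional. -/
theorem exists_blockSpace_of_dual (hn : 1 < (n : ℝ) / ∑ i, 1 / p i)
    (ht : (n : ℝ) / ∑ i, 1 / p i < t) (htr : t < r) (L : StrongDual ℂ (bmSpace p t r hp hr)) :
    ∃ g ∈ blockSpace p t r, (∀ f, L f = ∫ x, f.1 x * g x) ∧ blockNorm p t r g ≤ ‖L‖ := by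
  have _ : Fact (1 ≤ ENNReal.ofReal r.conjExponent) := ⟨one_le_ofReal_conjExponent hr⟩
  have _ : Fact (1 ≤ ENNReal.ofReal r) := ⟨ENNReal.one_le_ofReal.2 hr.le⟩
  have _ := (Real.HolderConjugate.conjExponent hr).symm.ennrealOfReal
  have hpq (i) : (p i).HolderConjugate (p i).conjExponent := .conjExponent (hp i)
  have hQr := ENNReal.toReal_ofReal (zero_lt_one.trans hr).le
  obtain ⟨h, hh, hLh⟩ := exists_seqPairing_bmEmbedding_eq (hq := fun i => (hpq i).symm.lt)
    (P := ENNReal.ofReal r.conjExponent) hpq ENNReal.ofReal_ne_top ENNReal.ofReal_ne_top hQr L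
  obtain ⟨g, hg⟩ := exists_isSynthesis hr hpq hn ht htr ENNReal.ofReal_ne_top
    ENNReal.ofReal_ne_top hQr h
  obtain ⟨c, hc, hch⟩ := hg.exists_isAdmissible hr (toReal_ofReal_conjExponent hr)
  refine ⟨g, ⟨c, hc⟩, fun f => ?_, ?_⟩
  · rw [hLh]
    exact (hg.integrable_and_integral_eq hpq ENNReal.ofReal_ne_top ENNReal.ofReal_ne_top hQr f).2
  · exact ((blockNorm_le_of_isAdmissible hc).trans hch.le).trans hh

/-- Each admissible coefficient family yields a family `h` of no larger norm representing `L`, and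
Hölder's inequality bounds `‖L‖` by `‖h‖`; the infimum follows. -/
theorem norm_le_blockNorm {g : (Fin n → ℝ) →ₘ[volume] ℂ} (hg : g ∈ blockSpace p t r)
    {L : StrongDual ℂ (bmSpace p t r hp hr)} (hL : ∀ f, L f = ∫ x, f.1 x * g x) :
    ‖L‖ ≤ blockNorm p t r g := by
  have _ : Fact (1 ≤ ENNReal.ofReal r.conjExponent) := ⟨one_le_ofReal_conjExponent hr⟩
  have _ : Fact (1 ≤ ENNReal.ofReal r) := ⟨ENNReal.one_le_ofReal.2 hr.le⟩
  have _ := (Real.HolderConjugate.conjExponent hr).symm.ennrealOfReal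
  have hpq (i) : (p i).HolderConjugate (p i).conjExponent := .conjExponent (hp i)
  have hQr := ENNReal.toReal_ofReal (zero_lt_one.trans hr).le
  obtain ⟨c₀, hc₀⟩ := hg
  refine le_csInf ⟨_, c₀, hc₀, rfl⟩ ?_
  rintro _ ⟨c, hc, rfl⟩
  obtain ⟨h, hh, hhc⟩ := hc.exists_isSynthesis hr (toReal_ofReal_conjExponent hr)
    (fun i => (hpq i).symm.lt)
  refine le_trans (L.opNorm_le_bound (norm_nonneg h) fun f => ?_) hhc
  rw [hL, ← (hh.integrable_and_integral_eq hpq ENNReal.ofReal_ne_top ENNReal.ofReal_ne_top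
    hQr f).2, ← (bmEmbedding hQr).norm_map f]
  exact norm_seqPairing_le hpq h _

theorem exists_dual_of_mem_blockSpace (hp : ∀ i, 1 < p i) (hr : 1 < r)
    {g : (Fin n → ℝ) →ₘ[volume] ℂ} (hg : g ∈ blockSpace p t r) :
    ∃ L : StrongDual ℂ (bmSpace p t r hp hr), ∀ f, L f = ∫ x, f.1 x * g x := by
  have _ : Fact (1 ≤ ENNReal.ofReal r.conjExponent) := ⟨one_le_ofReal_conjExponent hr⟩
  have _ : Fact (1 ≤ ENNReal.ofReal r) := ⟨ENNReal.one_le_ofReal.2 hr.le⟩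
  have _ := (Real.HolderConjugate.conjExponent hr).symm.ennrealOfReal
  have hpq (i) : (p i).HolderConjugate (p i).conjExponent := .conjExponent (hp i)
  obtain ⟨c, hc⟩ := hg
  obtain ⟨h, hh, -⟩ := hc.exists_isSynthesis hr (toReal_ofReal_conjExponent hr)
    (fun i => (hpq i).symm.lt)
  have hQr := ENNReal.toReal_ofReal (zero_lt_one.trans hr).le
  exact ⟨familyDual hpq hQr h, fun f => (hh.integrable_and_integral_eq hpq
    ENNReal.ofReal_ne_top ENNReal.ofReal_ne_top hQr f).2⟩

theorem bmSpace_reflexive :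
    Function.Surjective (NormedSpace.inclusionInDoubleDual ℂ (bmSpace p t r hp hr)) := by
  have _ : Fact (1 ≤ ENNReal.ofReal r.conjExponent) := ⟨one_le_ofReal_conjExponent hr⟩
  have _ : Fact (1 ≤ ENNReal.ofReal r) := ⟨ENNReal.one_le_ofReal.2 hr.le⟩
  have _ := (Real.HolderConjugate.conjExponent hr).symm.ennrealOfReal
  have hpq (i) : (p i).HolderConjugate (p i).conjExponent := .conjExponent (hp i)
  exact inclusionInDoubleDual_surjective (P := ENNReal.ofReal r.conjExponent) hpq
    (fun i => (hpq i).symm.lt) ENNReal.ofReal_ne_top ENNReal.ofReal_ne_top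
    (ENNReal.toReal_ofReal (zero_lt_one.trans hr).le)

end Duality

end MixedBourgainMorrey

end

theorem theorem5p8 {n : ℕ} (p : Fin n → ℝ) (t r : ℝ) (hp : ∀ i, 1 < p i)
    (hn : 1 < (n : ℝ) / ∑ i, 1 / p i) (ht : (n : ℝ) / ∑ i, 1 / p i < t) (htr : t < r) :
    -- every `g` in the block space defines a bounded functional, of norm `‖g‖`
    (∀ g ∈ MixedBourgainMorrey.blockSpace p t r,
      (∀ f : MixedBourgainMorrey.bmSpace p t r hp (hn.trans (ht.trans htr)),
        MeasureTheory.Integrable (fun x => f.1 x * g x) MeasureTheory.volume) ∧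
      ∃ L : StrongDual ℂ (MixedBourgainMorrey.bmSpace p t r hp (hn.trans (ht.trans htr))),
        (∀ f, L f = ∫ x, f.1 x * g x) ∧ ‖L‖ = MixedBourgainMorrey.blockNorm p t r g) ∧
    -- every bounded functional arises from exactly one such `g`
    (∀ L : StrongDual ℂ (MixedBourgainMorrey.bmSpace p t r hp (hn.trans (ht.trans htr))),
      ∃! g : (Fin n → ℝ) →ₘ[MeasureTheory.volume] ℂ,
        g ∈ MixedBourgainMorrey.blockSpace p t r ∧ ∀ f, L f = ∫ x, f.1 x * g x) ∧
    -- the mixed Bourgain–Morrey space is reflexive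
    Function.Surjective
      (NormedSpace.inclusionInDoubleDual ℂ
        (MixedBourgainMorrey.bmSpace p t r hp (hn.trans (ht.trans htr)))) := by
  have hr := hn.trans (ht.trans htr)
  refine ⟨fun g hg => ⟨MixedBourgainMorrey.integrable_of_mem_blockSpace hp hr hg, ?_⟩,
    fun L => ?_, MixedBourgainMorrey.bmSpace_reflexive⟩
  · obtain ⟨L, hL⟩ := MixedBourgainMorrey.exists_dual_of_mem_blockSpace hp hr hg
    refine ⟨L, hL, le_antisymm (MixedBourgainMorrey.norm_le_blockNorm hg hL) ?_⟩
    -- Hahn–Banach gives a representing `g'` of block norm at most `‖L‖`, and uniqueness identifies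
    -- it with `g`.
    obtain ⟨g', hg', hL', hle⟩ := MixedBourgainMorrey.exists_blockSpace_of_dual hn ht htr L
    rwa [MixedBourgainMorrey.aeEqFun_eq_of_forall_integral_mul_eq hn ht htr
      (MixedBourgainMorrey.integrable_of_mem_blockSpace hp hr hg)
      (MixedBourgainMorrey.integrable_of_mem_blockSpace hp hr hg')
      (fun f => (hL f).symm.trans (hL' f))]
  · obtain ⟨g, hg, hL, -⟩ := MixedBourgainMorrey.exists_blockSpace_of_dual hn ht htr L
    refine ⟨g, ⟨hg, hL⟩, fun g' ⟨hg', hL'⟩ => ?_⟩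
    exact MixedBourgainMorrey.aeEqFun_eq_of_forall_integral_mul_eq hn ht htr
      (MixedBourgainMorrey.integrable_of_mem_blockSpace hp hr hg')
      (MixedBourgainMorrey.integrable_of_mem_blockSpace hp hr hg)
      (fun f => (hL' f).symm.trans (hL f))
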